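/- Let $N(t)$, $t\ge 0$, be a mixed Poisson process whose structure cdf $L$ on $[0,\infty)$ is the distribution of a random variable $\Lambda\ge 0$ with $\mathbf{E}[\Lambda^2]<\infty$; that is, $N$ is a claim-counting process ($N(0)=0$, right-continuous paths with unit steps) whose finite-dimensional distributions are the mixtures, with respect to $dL(\lambda)$, of those of the homogeneous Poisson processes with rates $\lambda$. Let $0=T_0<T_1<T_2<\cdots$ be its arrival times and let $V_i=T_i-T_{i-1}$. Let $H_\ell$, $H_s$ be cdfs of random variables $Y_\ell$, $Y_s$ with finite second moments, and let $\beta\ge 0$. Suppose that, conditionally on the arrival process, the claim sizes $X_1,X_2,\dots$ are independent, and that $X_i$ depends on the arrival process only through $V_i$, with $$\mathbf{P}[X_i\le y\mid V_i=v]=(1-e^{-\beta v})H_\ell(y)+e^{-\beta v}H_s(y).$$ Put $S(t)=\sum_{i=1}^{N(t)}X_i$. Fractions in the integrands below are multiplied by positive powers of $\lambda$; when $\beta=\lambda=0$ these integrands are read as $0$. Then $\mathbf{E}[S^2(t)]<\infty$ for every $t\ge 0$, and the following hold. (1) As $t\to\infty$, $$\begin{aligned}\frac{\mathbf{E}[S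^2(t)]}{t}={}&\mathbf{E}[Y_\ell^2]\int_0^\infty\frac{\beta}{\beta+\lambda}\lambda\,dL(\lambda)+\mathbf{E}[Y_s^2]\int_0^\infty\frac{\lambda}{\beta+\lambda}\lambda\,dL(\lambda)\\&+(\mathbf{E}[Y_\ell])^2\int_0^\infty\Big(-\frac{4\beta^2\lambda^2}{(\beta+\lambda)^3}+t\,\frac{\beta^2\lambda^2}{(\beta+\lambda)^2}\Big)dL(\lambda)\\&+\mathbf{E}[Y_\ell]\mathbf{E}[Y_s]\int_0^\infty\Big(\frac{4\beta\lambda^2(\beta-\lambda)}{(\beta+\lambda)^3}+t\,\frac{2\beta\lambda^3}{(\beta+\lambda)^2}\Big)dL(\lambda)\\&+(\mathbf{E}[Y_s])^2\int_0^\infty\Big(\frac{4\beta\lambda^3}{(\beta+\lambda)^3}+t\,\frac{\lambda^4}{(\beta+\lambda)^2}\Big)dL(\lambda)+o(1).\end{aligned}$$ (2) $$\lim_{t\to\infty}\frac{\mathbf{E}[S^2(t)]}{t^2}=\int_0^\infty\Big(\mathbf{E}[Y_\ell]\frac{\beta}{\beta+\lambda}+\mathbf{E}[Y_s]\frac{\lambda}{\beta+\lambda}\Big)^2\lambda^2\,dL(\lambda).$$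 Suppose in addition that there is only one type of claims, that is, $Y_\ell$ and $Y_s$ are both distributed as a random variable $Y$. Then: (3) $\lim_{t\to\infty}\mathbf{E}[S^2(t)]/t^2=(\mathbf{E}[Y])^2\int_0^\infty\lambda^2\,dL(\lambda)$. (4) $\lim_{t\to\infty}\mathbf{Var}[S(t)]/t^2=(\mathbf{E}[Y])^2\,\mathbf{Var}[\Lambda]$. (5) If $\mathbf{Var}[\Lambda]=0$, then $\lim_{t\to\infty}\mathbf{Var}[S(t)]/t=\mathbf{E}[Y^2]\,\mathbf{E}[\Lambda]$. -/

import Mathlib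

open MeasureTheory ProbabilityTheory Filter Topology
open scoped NNReal ENNReal

noncomputable section

/-- A claim-counting process: `N t ω` is the number of claims arriving in `(0, t]`. The paths are
right-continuous non-decreasing step functions with unit steps, starting from `0`. -/
structure IsClaimCountingProcess {Ω : Type*} [MeasurableSpace Ω] (N : ℝ≥0 → Ω → ℕ) : Prop where
  measurable : ∀ t, Measurable (N t)
  zero : ∀ ω, N 0 ω = 0
  mono : ∀ ω, Monotone fun t => N t ω
  rightCont : ∀ ω t, ContinuousWithinAt (fun s => N s ω) (Set.Ici t) t
  unitSteps : ∀ ω t n, n ≤ N t ω → ∃ s ≤ t, N s ω = n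

/-- A mixed Poisson process with structure distribution `L` (the law of the random intensity `Λ`):
a claim-counting process whose increments over consecutive intervals are jointly distributed as the
`L`-mixture over `l` of the increments of homogeneous Poisson processes with rates `l`. -/
structure IsMixedPoissonProcess {Ω : Type*} [MeasurableSpace Ω] (N : ℝ≥0 → Ω → ℕ)
    (L : Measure ℝ≥0) (μ : Measure Ω) : Prop extends IsClaimCountingProcess N where
  increments : ∀ (n : ℕ) (t : Fin (n + 1) → ℝ≥0), Monotone t → ∀ k : Fin n → ℕ,
    μ {ω | ∀ i : Fin n, N (t i.succ) ω = N (t i.castSucc) ω + k i} =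
      ∫⁻ l, ∏ i : Fin n, poissonMeasure (l * (t i.succ - t i.castSucc)) {k i} ∂L

/-- The `i`-th arrival time `T i`, with `T 0 = 0`. It is meaningful only at those `ω` for which at
least `i` claims arrive, i.e. `∃ t, i ≤ N t ω`. -/
def arrivalTime {Ω : Type*} (N : ℝ≥0 → Ω → ℕ) (i : ℕ) (ω : Ω) : ℝ≥0 :=
  sInf {t : ℝ≥0 | i ≤ N t ω}

/-- The inter-claim time `V i = T i - T (i - 1)`, for `i ≥ 1`. -/
def interClaimTime {Ω : Type*} (N : ℝ≥0 → Ω → ℕ) (i : ℕ) (ω : Ω) : ℝ :=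
  (arrivalTime N i ω : ℝ) - (arrivalTime N (i - 1) ω : ℝ)

/-- The σ-algebra generated by the claim arrival process. -/
abbrev arrivalSigma {Ω : Type*} (N : ℝ≥0 → Ω → ℕ) : MeasurableSpace Ω :=
  ⨆ t : ℝ≥0, MeasurableSpace.comap (N t) ⊤

/-- The conditional cdf of a claim size given that the preceding inter-claim time equals `v`:
`y ↦ (1 - e^{-β v}) H_ℓ(y) + e^{-β v} H_s(y)`, with `H_ℓ`, `H_s` the cdfs of `Hl`, `Hs`. -/
def claimCdf (β : ℝ) (Hl Hs : Measure ℝ) (v y : ℝ) : ℝ :=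
  (1 - Real.exp (-(β * v))) * cdf Hl y + Real.exp (-(β * v)) * cdf Hs y

/-- The claim sizes `X 1, X 2, …` depend on the arrival process only through the respective
inter-claim times: conditionally on the arrival process they are independent, `X i` having the
conditional cdf `claimCdf β Hl Hs (V i)`. The condition on the first `n` claims is imposed where
at least `n` claims arrive. -/
structure IsClaimSizes {Ω : Type*} [MeasurableSpace Ω] (X : ℕ → Ω → ℝ) (N : ℝ≥0 → Ω → ℕ)
    (β : ℝ) (Hl Hs : Measure ℝ) (μ : Measure Ω) : Prop where
  measurable : ∀ i, Measurable (X i)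
  condLaw : ∀ (n : ℕ) (y : ℕ → ℝ), ∀ᵐ ω ∂μ, (∃ t, n ≤ N t ω) →
    (μ⟦{ω' | ∀ i ∈ Finset.Icc 1 n, X i ω' ≤ y i} | arrivalSigma N⟧) ω =
      ∏ i ∈ Finset.Icc 1 n, claimCdf β Hl Hs (interClaimTime N i ω) (y i)

/-- The aggregate claim `S t = X 1 + ⋯ + X (N t)`. -/
def aggregateClaim {Ω : Type*} (X : ℕ → Ω → ℝ) (N : ℝ≥0 → Ω → ℕ) (t : ℝ≥0) (ω : Ω) : ℝ :=
  ∑ i ∈ Finset.Icc 1 (N t ω), X i ω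

end

/-! Conditionally on the arrivals the claims are independent, and the conditional mean and second
moment of `X i` both have the form `a + b exp (-β V i)`. Hence `E[S²(t)]` is the expectation of a
sum of such weights (diagonal terms) plus twice the expectation of a sum of products of two weights
(off-diagonal terms). Only the arrival process is left (`IsClaimSizes.aggregateClaim_sq`).

These two expectations are found without the joint law of the arrival times. Cut `(0, t]` into `n`
equal cells. At rate `l` the cells are hit independently with probability `1 - exp (-l t / n)`, so
the state `(R, W, U)` is a Markov chain, and the means of `R`, `W`, `R W`, `U` obey a closed linear
recursion with an explicit solution, whose limit in `n` is `firstMoment` and `secondMoment`. On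
every path the cells eventually contain at most one claim each, and the discrete sums converge to
the true ones. Dominated convergence on `Ω` and over `L` identifies the two limits
(`integral_sum_claimWeight`). Only finite-dimensional distributions are used, so mixing over `L`
costs nothing.

The explicit moments are quadratic polynomials in `t` up to a remainder bounded uniformly in `l` and
`t`, because `β / (β + l)`, `l / (β + l)`, `exp (-x)` and `x exp (-x)` all lie in `[0, 1]`
(`abs_moments_sub_le`). Therefore `E[S²(t)] = A t + B t² + O(1)`, which gives (1) and (2). With one
type of claims the weights are constant, the mean of `S(t)` is exactly linear in `t`, and the
variance statements follow by subtraction. -/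

/-- The state `(R, W, U)` of the discretized claim scheme moves on according to whether a claim
arrives in the next cell: `R` is the discount factor since the last arrival, `W` the sum of the
weights `a + b R` of the claims so far, `U` the sum of the products of the weights of two claims. -/
def discreteStep (θ a b : ℝ) (σ : ℝ × ℝ × ℝ) (B : Bool) : ℝ × ℝ × ℝ :=
  if B then (1, σ.2.1 + (a + b * (θ * σ.1)), σ.2.2 + (a + b * (θ * σ.1)) * σ.2.1)
  else (θ * σ.1, σ.2.1, σ.2.2)

/-- The state after `n` cells. -/
def discreteState (θ a b : ℝ) : (n : ℕ) → (Fin n → Bool) → ℝ × ℝ × ℝ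
  | 0, _ => (1, 0, 0)
  | n + 1, ε => discreteStep θ a b (discreteState θ a b n (Fin.init ε)) (ε (Fin.last n))

/-- The mean of `f` of the state after `n` cells, when a claim arrives in each cell with
probability `p`, independently of the other cells. -/
noncomputable def discreteMean (p θ a b : ℝ) (n : ℕ) (f : ℝ × ℝ × ℝ → ℝ) : ℝ :=
  ∑ ε : Fin n → Bool, (∏ i, if ε i then p else 1 - p) * f (discreteState θ a b n ε)

/-! ### Moment recursions of the discretized scheme -/

section Recursion

variable (p θ a b : ℝ)

/-- The last cell is independent of the first `n`, so it can be averaged out first. -/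
lemma discreteMean_succ (n : ℕ) (f : ℝ × ℝ × ℝ → ℝ) :
    discreteMean p θ a b (n + 1) f = discreteMean p θ a b n
      (fun σ => p * f (discreteStep θ a b σ true) + (1 - p) * f (discreteStep θ a b σ false)) := by
  unfold discreteMean
  rw [← (Fin.snocEquiv (fun _ : Fin (n + 1) => Bool)).sum_comp, Fintype.sum_prod_type]
  rw [Finset.sum_comm]
  refine Finset.sum_congr rfl fun ε _ => ?_
  simp only [Fintype.sum_bool, Fin.prod_univ_castSucc, Fin.snocEquiv, Equiv.coe_fn_mk,
    Fin.snoc_castSucc, Fin.snoc_last, discreteState, Fin.init_snoc]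
  simp
  ring

lemma discreteMean_add (n : ℕ) (f g : ℝ × ℝ × ℝ → ℝ) :
    discreteMean p θ a b n (fun σ => f σ + g σ) =
      discreteMean p θ a b n f + discreteMean p θ a b n g := by
  simp [discreteMean, mul_add, Finset.sum_add_distrib]

lemma discreteMean_const_mul (n : ℕ) (c : ℝ) (f : ℝ × ℝ × ℝ → ℝ) :
    discreteMean p θ a b n (fun σ => c * f σ) = c * discreteMean p θ a b n f := by
  simp only [discreteMean, Finset.mul_sum]
  exact Finset.sum_congr rfl fun ε _ => by ring

lemma discreteMean_const (n : ℕ) (c : ℝ) : discreteMean p θ a b n (fun _ => c) = c := by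
  induction n with
  | zero => simp [discreteMean]
  | succ n ih =>
    rw [discreteMean_succ]
    convert ih using 3
    ring

lemma discreteMean_const_add (n : ℕ) (c : ℝ) (f : ℝ × ℝ × ℝ → ℝ) :
    discreteMean p θ a b n (fun σ => c + f σ) = c + discreteMean p θ a b n f := by
  rw [discreteMean_add, discreteMean_const]

/-- The means of `R`, `W`, `R W` and `U` satisfy a closed system of linear recursions. -/
structure IsMomentRecursion (p θ a b : ℝ) (r w x u : ℕ → ℝ) : Prop where
  r_zero : r 0 = 1
  w_zero : w 0 = 0
  x_zero : x 0 = 0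
  u_zero : u 0 = 0
  r_succ : ∀ n, r (n + 1) = p + θ * (1 - p) * r n
  w_succ : ∀ n, w (n + 1) = w n + p * (a + b * θ * r n)
  x_succ : ∀ n, x (n + 1) = θ * (1 - p) * x n + p * (w n + a + b * θ * r n)
  u_succ : ∀ n, u (n + 1) = u n + p * (a * w n + b * θ * x n)

/-- The system closes because a claim resets `R` to `1`: then `R W` becomes the new `W`, and the
increment of `U` is linear in `W` and `R W`. No mean of `R²` ever appears. -/
lemma isMomentRecursion_discreteMean :
    IsMomentRecursion p θ a b (fun n => discreteMean p θ a b n fun σ => σ.1)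
      (fun n => discreteMean p θ a b n fun σ => σ.2.1)
      (fun n => discreteMean p θ a b n fun σ => σ.1 * σ.2.1)
      (fun n => discreteMean p θ a b n fun σ => σ.2.2) where
  r_zero := by simp [discreteMean, discreteState]
  w_zero := by simp [discreteMean, discreteState]
  x_zero := by simp [discreteMean, discreteState]
  u_zero := by simp [discreteMean, discreteState]
  r_succ n := by
    rw [discreteMean_succ, ← discreteMean_const_mul, ← discreteMean_const_add]
    congr 1; ext σ
    simp [discreteStep]; ring
  w_succ n := by
    have h : p * (a + b * θ * discreteMean p θ a b n fun σ => σ.1) =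
        p * a + (p * b * θ) * discreteMean p θ a b n fun σ => σ.1 := by ring
    rw [h, discreteMean_succ, ← discreteMean_const_mul, ← discreteMean_const_add,
      ← discreteMean_add]
    congr 1; ext σ
    simp [discreteStep]; ring
  x_succ n := by
    have h : θ * (1 - p) * (discreteMean p θ a b n fun σ => σ.1 * σ.2.1) +
        p * ((discreteMean p θ a b n fun σ => σ.2.1) + a +
          b * θ * discreteMean p θ a b n fun σ => σ.1) =
        θ * (1 - p) * (discreteMean p θ a b n fun σ => σ.1 * σ.2.1) +
        (p * (discreteMean p θ a b n fun σ => σ.2.1) + (p * a +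
          (p * b * θ) * discreteMean p θ a b n fun σ => σ.1)) := by ring
    rw [h, discreteMean_succ]
    simp only [← discreteMean_const_mul]
    rw [← discreteMean_const_add]
    simp only [← discreteMean_add]
    congr 1; ext σ
    simp [discreteStep]; ring
  u_succ n := by
    have h : p * (a * (discreteMean p θ a b n fun σ => σ.2.1) +
          b * θ * discreteMean p θ a b n fun σ => σ.1 * σ.2.1) =
        (p * a) * (discreteMean p θ a b n fun σ => σ.2.1) +
          (p * b * θ) * discreteMean p θ a b n fun σ => σ.1 * σ.2.1 := by ring
    rw [h, discreteMean_succ]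
    simp only [← discreteMean_const_mul]
    simp only [← discreteMean_add]
    congr 1; ext σ
    simp [discreteStep]; ring

end Recursion

/-! ### Bounds and closed forms for the recursion -/

namespace IsMomentRecursion

variable {p θ a b K : ℝ} {r w x u : ℕ → ℝ}

section Bounds

lemma r_mem (h : IsMomentRecursion p θ a b r w x u) (hp0 : 0 ≤ p) (hp1 : p ≤ 1) (hθ0 : 0 ≤ θ)
    (hθ1 : θ ≤ 1) (n : ℕ) : 0 ≤ r n ∧ r n ≤ 1 := by
  induction n with
  | zero => simp [h.r_zero]
  | succ n ih =>
    rw [h.r_succ]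
    have h1 : 0 ≤ θ * (1 - p) := mul_nonneg hθ0 (by linarith)
    have h2 : θ * (1 - p) ≤ 1 - p := mul_le_of_le_one_left (by linarith) hθ1
    have h3 : θ * (1 - p) * r n ≤ θ * (1 - p) := mul_le_of_le_one_right h1 ih.2
    exact ⟨by have := mul_nonneg h1 ih.1; linarith, by linarith⟩

lemma abs_weight_le (h : IsMomentRecursion p θ a b r w x u) (hp0 : 0 ≤ p) (hp1 : p ≤ 1)
    (hθ0 : 0 ≤ θ) (hθ1 : θ ≤ 1) (hK : |a| + |b| ≤ K) (n : ℕ) : |a + b * θ * r n| ≤ K := by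
  obtain ⟨h0, h1⟩ := h.r_mem hp0 hp1 hθ0 hθ1 n
  have h2 : θ * r n ≤ 1 := mul_le_one₀ hθ1 h0 h1
  calc |a + b * θ * r n| ≤ |a| + |b * θ * r n| := abs_add_le _ _
    _ = |a| + |b| * (θ * r n) := by
      rw [mul_assoc, abs_mul b, abs_of_nonneg (mul_nonneg hθ0 h0)]
    _ ≤ |a| + |b| := by gcongr; exact mul_le_of_le_one_right (abs_nonneg _) h2
    _ ≤ K := hK

/-- This bound and the next two depend on `n` only through `n p ≤ l t`; they provide the dominating
functions over `L`. -/
lemma abs_w_le (h : IsMomentRecursion p θ a b r w x u) (hp0 : 0 ≤ p) (hp1 : p ≤ 1)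
    (hθ0 : 0 ≤ θ) (hθ1 : θ ≤ 1) (hK : |a| + |b| ≤ K) (n : ℕ) : |w n| ≤ K * (n * p) := by
  induction n with
  | zero => simp [h.w_zero]
  | succ n ih =>
    rw [h.w_succ]
    have h1 := h.abs_weight_le hp0 hp1 hθ0 hθ1 hK n
    calc |w n + p * (a + b * θ * r n)| ≤ |w n| + |p * (a + b * θ * r n)| := abs_add_le _ _
      _ ≤ K * (n * p) + p * K := by
        rw [abs_mul, abs_of_nonneg hp0]
        gcongr
      _ = _ := by push_cast; ring

lemma abs_x_le (h : IsMomentRecursion p θ a b r w x u) (hp0 : 0 ≤ p) (hp1 : p ≤ 1)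
    (hθ0 : 0 ≤ θ) (hθ1 : θ ≤ 1) (hK : |a| + |b| ≤ K) (n : ℕ) : |x n| ≤ K * (n * p) := by
  induction n with
  | zero => simp [h.x_zero]
  | succ n ih =>
    rw [h.x_succ]
    have h1 := h.abs_weight_le hp0 hp1 hθ0 hθ1 hK n
    have h2 := h.abs_w_le hp0 hp1 hθ0 hθ1 hK n
    have h3 : 0 ≤ 1 - p := by linarith
    calc |θ * (1 - p) * x n + p * (w n + a + b * θ * r n)|
        ≤ |θ * (1 - p) * x n| + |p * (w n + (a + b * θ * r n))| := by
          rw [← add_assoc]; exact abs_add_le _ _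
      _ = θ * (1 - p) * |x n| + p * |w n + (a + b * θ * r n)| := by
          rw [abs_mul, abs_mul p, abs_of_nonneg hp0, abs_of_nonneg (mul_nonneg hθ0 h3)]
      _ ≤ 1 * (1 - p) * (K * (n * p)) + p * (K * (n * p) + K) := by
          gcongr
          exact (abs_add_le _ _).trans (add_le_add h2 h1)
      _ = _ := by push_cast; ring

lemma abs_u_le (h : IsMomentRecursion p θ a b r w x u) (hp0 : 0 ≤ p) (hp1 : p ≤ 1)
    (hθ0 : 0 ≤ θ) (hθ1 : θ ≤ 1) (hK : |a| + |b| ≤ K) (n : ℕ) : |u n| ≤ (K * (n * p)) ^ 2 := by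
  have hK0 : 0 ≤ K := (add_nonneg (abs_nonneg a) (abs_nonneg b)).trans hK
  induction n with
  | zero => simp [h.u_zero]
  | succ n ih =>
    rw [h.u_succ]
    have h1 := h.abs_w_le hp0 hp1 hθ0 hθ1 hK n
    have h2 := h.abs_x_le hp0 hp1 hθ0 hθ1 hK n
    have h3 : |a * w n + b * θ * x n| ≤ K * (K * (n * p)) := by
      calc |a * w n + b * θ * x n| ≤ |a * w n| + |b * θ * x n| := abs_add_le _ _
        _ = |a| * |w n| + |b| * (θ * |x n|) := by
          rw [abs_mul, abs_mul, abs_mul, abs_of_nonneg hθ0, mul_assoc]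
        _ ≤ |a| * (K * (n * p)) + |b| * (1 * (K * (n * p))) := by gcongr
        _ = (|a| + |b|) * (K * (n * p)) := by ring
        _ ≤ _ := by gcongr
    calc |u n + p * (a * w n + b * θ * x n)| ≤ |u n| + p * |a * w n + b * θ * x n| := by
          refine (abs_add_le _ _).trans_eq ?_
          rw [abs_mul p, abs_of_nonneg hp0]
      _ ≤ (K * (n * p)) ^ 2 + p * (K * (K * (n * p))) := by gcongr
      _ ≤ (K * ((n + 1 : ℕ) * p)) ^ 2 := by
        push_cast
        -- This is the slack: the square grows by `K² p² (2 n + 1)`, the left side by `K² p² n`.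
        have : 0 ≤ K ^ 2 * p ^ 2 * (n + 1) := by positivity
        nlinarith

end Bounds

section ClosedForm

/-- `κ` is the fixed point of the recursion for `r` and `z` its contraction ratio; writing `p = κ (1
- z)` keeps the induction free of division. -/
lemma r_eq (h : IsMomentRecursion p θ a b r w x u) {z κ : ℝ} (hz : z = θ * (1 - p))
    (hκ : p = κ * (1 - z)) (n : ℕ) : r n = κ + (1 - κ) * z ^ n := by
  induction n with
  | zero => simp [h.r_zero]
  | succ n ih => rw [h.r_succ, ← hz, ih, hκ]; ring

lemma w_eq (h : IsMomentRecursion p θ a b r w x u) {z κ : ℝ} (hz : z = θ * (1 - p))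
    (hκ : p = κ * (1 - z)) (n : ℕ) :
    w n = p * (a + b * θ * κ) * n + b * θ * (1 - κ) * κ * (1 - z ^ n) := by
  induction n with
  | zero => simp [h.w_zero]
  | succ n ih => rw [h.w_succ, h.r_eq hz hκ, ih, hκ]; push_cast; ring

/-- The term `n z ^ n` is a resonance: `x` contracts with ratio `z` and is driven by `r` and `w`,
which contain `z ^ n` themselves. The division by `z` stands for `n z ^ (n - 1)`. -/
lemma x_eq (h : IsMomentRecursion p θ a b r w x u) {z κ : ℝ} (hz : z = θ * (1 - p))
    (hκ : p = κ * (1 - z)) (hz0 : z ≠ 0) (n : ℕ) :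
    x n = p * κ * (a + b * θ * κ) * n + κ * (1 - κ) * (a + 2 * (b * θ) * κ) * (1 - z ^ n)
      + κ * (1 - z) * (b * θ) * (1 - κ) ^ 2 / z * n * z ^ n := by
  induction n with
  | zero => simp [h.x_zero]
  | succ n ih =>
    rw [h.x_succ, h.w_eq hz hκ, h.r_eq hz hκ, ih, ← hz, hκ]; push_cast
    field_simp
    ring

lemma u_eq (h : IsMomentRecursion p θ a b r w x u) {z κ : ℝ} (hz : z = θ * (1 - p))
    (hκ : p = κ * (1 - z)) (hz0 : z ≠ 0) (n : ℕ) :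
    u n = (p * (a + b * θ * κ)) ^ 2 * (n * (n - 1) / 2)
      + 2 * (b * θ) * (1 - κ) * κ * (a + b * θ * κ) * (p * n)
      - 2 * (b * θ) * (1 - κ) * κ ^ 2 * (a + b * θ * κ) * (1 - z ^ n)
      + κ ^ 2 * (b * θ) ^ 2 * (1 - κ) ^ 2 * (1 - z ^ n - n * (1 - z) * z ^ n / z) := by
  induction n with
  | zero => simp [h.u_zero]
  | succ n ih =>
    rw [h.u_succ, h.w_eq hz hκ, h.x_eq hz hκ hz0, ih, hκ]; push_cast
    field_simp
    ring

end ClosedForm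

end IsMomentRecursion

/-! ### Limit of the discretized moments as the mesh tends to zero -/

/-- The mean of the sum of the weights `a + b exp (-β V i)` of the claims up to time `t`, for
arrivals with rate `l`. -/
noncomputable def firstMoment (a b β t l : ℝ) : ℝ :=
  l * t * (a + b * (l / (β + l)))
    + b * (β / (β + l)) * (l / (β + l)) * (1 - Real.exp (-((β + l) * t)))

/-- The mean of the sum of the products of the weights of two different claims up to time `t`. -/
noncomputable def secondMoment (a b β t l : ℝ) : ℝ :=
  (l * t * (a + b * (l / (β + l)))) ^ 2 / 2
    + 2 * b * (β / (β + l)) * (l / (β + l)) * (a + b * (l / (β + l))) * (l * t)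
    - 2 * b * (β / (β + l)) * (l / (β + l)) ^ 2 * (a + b * (l / (β + l)))
      * (1 - Real.exp (-((β + l) * t)))
    + (l / (β + l)) ^ 2 * b ^ 2 * (β / (β + l)) ^ 2
      * (1 - Real.exp (-((β + l) * t)) - (β + l) * t * Real.exp (-((β + l) * t)))

lemma tendsto_nat_mul_one_sub_exp (c : ℝ) :
    Tendsto (fun n : ℕ => (n : ℝ) * (1 - Real.exp (-(c / n)))) atTop (𝓝 c) := by
  have h1 : HasDerivAt (fun s : ℝ => 1 - Real.exp (-(c * s))) c 0 := by
    have := (((hasDerivAt_id (0 : ℝ)).const_mul c).neg.exp).const_sub 1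
    simpa using! this
  have h2 := h1.tendsto_slope_zero_right
  have h3 : Tendsto (fun n : ℕ => ((n : ℝ))⁻¹) atTop (𝓝[>] 0) :=
    tendsto_inv_atTop_nhdsGT_zero.comp tendsto_natCast_atTop_atTop
  refine (h2.comp h3).congr fun n => ?_
  simp [div_eq_mul_inv]

section Limits

variable {a b β t l : ℝ}

/-- After `n` cells `z ^ n` equals `exp (-(β + l) t)` exactly, so in the closed forms only `n p`, `n
(1 - z)`, `κ` and quantities tending to `0` or `1` have to be passed to the limit. -/
lemma tendsto_discrete_moments (hβ : 0 ≤ β) (hl : 0 ≤ l) (r w x u : ℕ → ℕ → ℝ)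
    (h : ∀ n : ℕ, IsMomentRecursion (1 - Real.exp (-(l * t / n))) (Real.exp (-(β * t / n))) a b
      (r n) (w n) (x n) (u n)) (ht : 0 < t) :
    Tendsto (fun n => w n n) atTop (𝓝 (firstMoment a b β t l)) ∧
      Tendsto (fun n => u n n) atTop (𝓝 (secondMoment a b β t l)) := by
  -- For `l = 0` the sum `β + l` may vanish; but then `p = 0` and no claim ever arrives.
  rcases hl.eq_or_lt with rfl | hl
  · have hw : ∀ n k, w n k = 0 := fun n k => by
      induction k with
      | zero => exact (h n).w_zero
      | succ k ih => rw [(h n).w_succ, ih]; simp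
    have hu : ∀ n k, u n k = 0 := fun n k => by
      induction k with
      | zero => exact (h n).u_zero
      | succ k ih => rw [(h n).u_succ, ih]; simp
    simp [hw, hu, firstMoment, secondMoment]
  have hc : 0 < β + l := by linarith
  set p : ℕ → ℝ := fun n => 1 - Real.exp (-(l * t / n)) with hp
  set θ : ℕ → ℝ := fun n => Real.exp (-(β * t / n)) with hθ
  set z : ℕ → ℝ := fun n => Real.exp (-((β + l) * t / n)) with hz
  have hz' : ∀ n, z n = θ n * (1 - p n) := fun n => by
    simp only [hz, hθ, hp, sub_sub_cancel, ← Real.exp_add]; congr 1; ring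
  have hz0 : ∀ n, z n ≠ 0 := fun n => (Real.exp_pos _).ne'
  have hz1 : ∀ n : ℕ, 0 < n → 1 - z n ≠ 0 := fun n hn => by
    have : z n < 1 := by
      simp only [hz]; rw [Real.exp_lt_one_iff]; simp only [Left.neg_neg_iff]; positivity
    linarith
  set κ : ℕ → ℝ := fun n => p n / (1 - z n) with hκ
  have hκ' : ∀ n : ℕ, 0 < n → p n = κ n * (1 - z n) := fun n hn => by
    simp only [hκ]; rw [div_mul_cancel₀ _ (hz1 n hn)]
  have hpow : ∀ n : ℕ, 0 < n → z n ^ n = Real.exp (-((β + l) * t)) := fun n hn => by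
    simp only [hz]; rw [← Real.exp_nat_mul]; congr 1; field_simp
  have lp : Tendsto (fun n : ℕ => (n : ℝ) * p n) atTop (𝓝 (l * t)) :=
    tendsto_nat_mul_one_sub_exp (l * t)
  have lz1 : Tendsto (fun n : ℕ => (n : ℝ) * (1 - z n)) atTop (𝓝 ((β + l) * t)) :=
    tendsto_nat_mul_one_sub_exp ((β + l) * t)
  have lexp : ∀ d : ℝ, Tendsto (fun n : ℕ => Real.exp (-(d / n))) atTop (𝓝 1) := fun d => by
    have := (tendsto_const_div_atTop_nhds_zero_nat d).neg.rexp
    simpa using this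
  have lz : Tendsto z atTop (𝓝 1) := lexp _
  have lθ : Tendsto θ atTop (𝓝 1) := lexp _
  have lp0 : Tendsto p atTop (𝓝 0) := by simpa using (lexp (l * t)).const_sub 1
  have lκ : Tendsto κ atTop (𝓝 (l / (β + l))) := by
    have := lp.div lz1 (by positivity)
    rw [mul_div_mul_right _ _ ht.ne'] at this
    refine this.congr' ?_
    filter_upwards [eventually_gt_atTop 0] with n hn
    have : (n : ℝ) ≠ 0 := by positivity
    simp only [hκ, Pi.div_apply]
    rw [mul_div_mul_left _ _ this]
  have lη : Tendsto (fun n => 1 - κ n) atTop (𝓝 (β / (β + l))) := by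
    have := lκ.const_sub 1
    convert this using 2
    field_simp; ring
  have lb : Tendsto (fun n => b * θ n) atTop (𝓝 b) := by simpa using lθ.const_mul b
  have lD : Tendsto (fun n => a + b * θ n * κ n) atTop (𝓝 (a + b * (l / (β + l)))) :=
    (lb.mul lκ).const_add a
  set E := Real.exp (-((β + l) * t)) with hE
  constructor
  · have := ((lp.mul lD).add (((lb.mul lη).mul lκ).mul_const (1 - E)))
    refine this.congr' ?_
    filter_upwards [eventually_gt_atTop 0] with n hn
    rw [(h n).w_eq (hz' n) (hκ' n hn), hpow n hn]
    ring
  -- Here `n (n - 1) p²` is split as `(n p)² - (n p) p`.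
  · have l1 := (((lp.pow 2).sub (lp.mul lp0)).div_const 2).mul (lD.pow 2)
    have l2 := ((((lb.const_mul 2).mul lη).mul lκ).mul lD).mul lp
    have l3 := ((((lb.const_mul 2).mul lη).mul (lκ.pow 2)).mul lD).mul_const (1 - E)
    have l4 := (((lκ.pow 2).mul (lb.pow 2)).mul (lη.pow 2)).mul
      (((lz1.mul_const E).div lz one_ne_zero).const_sub (1 - E))
    have := ((l1.add l2).sub l3).add l4
    convert this.congr' ?_ using 2
    · simp only [secondMoment, hE]; ring
    filter_upwards [eventually_gt_atTop 0] with n hn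
    rw [(h n).u_eq (hz' n) (hκ' n hn) (hz0 n), hpow n hn]
    simp only [Pi.div_apply]
    ring

end Limits

/-! ### Discretization along a single path -/

section Paths

variable {Ω : Type*} {N : ℝ≥0 → Ω → ℕ} {ω : Ω} {i j : ℕ} {s t : ℝ≥0}

@[simp]
lemma arrivalTime_zero : arrivalTime N 0 ω = 0 := by
  exact le_antisymm (csInf_le (OrderBot.bddBelow _) (Nat.zero_le _)) zero_le

/-- Whether a claim arrives in the cell `(k h, (k + 1) h]`, for `k < n`. -/
def gridHits (N : ℝ≥0 → Ω → ℕ) (h : ℝ≥0) (ω : Ω) (n : ℕ) : Fin n → Bool :=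
  fun k => decide (N ((k : ℕ) * h) ω < N (((k : ℕ) + 1 : ℕ) * h) ω)

lemma discreteState_gridHits_succ (θ a b : ℝ) (h : ℝ≥0) (n : ℕ) :
    discreteState θ a b (n + 1) (gridHits N h ω (n + 1)) =
      discreteStep θ a b (discreteState θ a b n (gridHits N h ω n))
        (decide (N (n * h) ω < N ((n + 1 : ℕ) * h) ω)) := rfl

/-- The weight `a + b exp (-β V)` of the claim with index `i + 1`. -/
noncomputable def claimWeight (N : ℝ≥0 → Ω → ℕ) (a b β : ℝ) (i : ℕ) (ω : Ω) : ℝ :=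
  a + b * Real.exp (-(β * interClaimTime N (i + 1) ω))

/-- The weight of the claim with index `i + 1`, with arrival times rounded up to the grid. -/
noncomputable def gridWeight (N : ℝ≥0 → Ω → ℕ) (a b β : ℝ) (h : ℝ≥0) (i : ℕ) (ω : Ω) : ℝ :=
  a + b * Real.exp (-(β * (h * ⌈arrivalTime N (i + 1) ω / h⌉₊ - h * ⌈arrivalTime N i ω / h⌉₊)))

lemma tendsto_mesh (t : ℝ≥0) : Tendsto (fun n : ℕ => t / (n : ℝ≥0)) atTop (𝓝 0) := by
  rw [← NNReal.tendsto_coe]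
  simpa using tendsto_const_div_atTop_nhds_zero_nat (t : ℝ)

/-- Rounding up to a grid of mesh `h` moves a time by at most `h`. -/
lemma tendsto_gridWeight (N : ℝ≥0 → Ω → ℕ) (a b β : ℝ) (ht : 0 < t) (i : ℕ) (ω : Ω) :
    Tendsto (fun n : ℕ => gridWeight N a b β (t / n) i ω) atTop (𝓝 (claimWeight N a b β i ω)) := by
  have key : ∀ s : ℝ≥0, Tendsto (fun n : ℕ => ((t / n : ℝ≥0) : ℝ) * ⌈s / (t / n)⌉₊) atTop
      (𝓝 s) := fun s => by
    have h1 : Tendsto (fun n : ℕ => (s : ℝ) + ((t / n : ℝ≥0) : ℝ)) atTop (𝓝 s) := by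
      simpa only [NNReal.coe_zero, add_zero] using
        (NNReal.tendsto_coe.2 (tendsto_mesh t)).const_add (s : ℝ)
    refine tendsto_of_tendsto_of_tendsto_of_le_of_le' tendsto_const_nhds h1 ?_ ?_
    all_goals
      filter_upwards [eventually_gt_atTop 0] with n hn
      have hpos : 0 < t / n := by positivity
    · have := (div_le_iff₀ hpos).1 (Nat.le_ceil (s / (t / n)))
      rw [mul_comm]
      exact_mod_cast this
    · have h2 := (Nat.ceil_lt_add_one (zero_le (a := s / (t / n)))).le
      have h3 : (t / n) * (⌈s / (t / n)⌉₊ : ℝ≥0) ≤ (t / n) * (s / (t / n) + 1) := by gcongr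
      rw [mul_add, mul_div_cancel₀ _ hpos.ne', mul_one] at h3
      exact_mod_cast h3
  unfold gridWeight claimWeight interClaimTime
  exact (((((key _).sub (key _)).const_mul β).neg.rexp).const_mul b).const_add a

variable [MeasurableSpace Ω]

namespace IsClaimCountingProcess

/-- The infimum is attained: by right-continuity the integer-valued path is constant on some `[T,
e)`, which meets the set. The hypothesis excludes the default value of `sInf ∅`. -/
lemma le_arrivalTime (hN : IsClaimCountingProcess N) (hi : i ≤ N t ω) :
    i ≤ N (arrivalTime N i ω) ω := by
  set T := arrivalTime N i ω
  have h1 : {s | N s ω = N T ω} ∈ 𝓝[≥] T := 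
    (hN.rightCont ω T).preimage_mem_nhdsWithin (t := {N T ω}) (mem_nhds_discrete.2 rfl)
  obtain ⟨e, he, hsub⟩ := (mem_nhdsGE_iff_exists_Ico_subset).1 h1
  obtain ⟨s, hs, hse⟩ := exists_lt_of_csInf_lt (s := {t : ℝ≥0 | i ≤ N t ω}) ⟨t, hi⟩ he
  have h2 : T ≤ s := csInf_le (OrderBot.bddBelow _) hs
  have h3 : N s ω = N T ω := hsub ⟨h2, hse⟩
  exact h3 ▸ hs

lemma arrivalTime_le_iff (hN : IsClaimCountingProcess N) (hi : i ≤ N t ω) :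
    arrivalTime N i ω ≤ s ↔ i ≤ N s ω :=
  ⟨fun h => (hN.le_arrivalTime hi).trans (hN.mono ω h),
    fun h => csInf_le (OrderBot.bddBelow _) h⟩

/-- Unit steps rule out overshooting: level `i` is attained at some time up to the arrival time, and
minimality makes the two equal. This is why arrival times are strictly increasing. -/
lemma apply_arrivalTime (hN : IsClaimCountingProcess N) (hi : i ≤ N t ω) :
    N (arrivalTime N i ω) ω = i := by
  obtain ⟨s, hs, hsi⟩ := hN.unitSteps ω _ i (hN.le_arrivalTime hi)
  rwa [le_antisymm hs ((hN.arrivalTime_le_iff hi).2 hsi.ge)] at hsi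

lemma arrivalTime_lt (hN : IsClaimCountingProcess N) (hij : i < j) (hj : j ≤ N t ω) :
    arrivalTime N i ω < arrivalTime N j ω := by
  rw [← not_le, hN.arrivalTime_le_iff hj, hN.apply_arrivalTime (hij.le.trans hj), not_le]
  exact hij

lemma interClaimTime_nonneg (hN : IsClaimCountingProcess N) (hi : i ≤ N t ω) :
    0 ≤ interClaimTime N i ω := by
  rw [interClaimTime, sub_nonneg, NNReal.coe_le_coe]
  rcases i with - | i
  · simp
  · exact (hN.arrivalTime_lt (Nat.lt_succ_self i) hi).le

end IsClaimCountingProcess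

/-- Every hit cell contains at least one claim, so the number of weights counted is at most `N`,
however coarse the grid. This gives the dominating functions on `Ω`. -/
lemma IsClaimCountingProcess.discreteState_bound (hN : IsClaimCountingProcess N) {θ a b K : ℝ}
    (hθ0 : 0 ≤ θ) (hθ1 : θ ≤ 1) (hK : |a| + |b| ≤ K) (h : ℝ≥0) (n : ℕ) :
    (0 ≤ (discreteState θ a b n (gridHits N h ω n)).1 ∧
      (discreteState θ a b n (gridHits N h ω n)).1 ≤ 1) ∧
    |(discreteState θ a b n (gridHits N h ω n)).2.1| ≤ K * N (n * h) ω ∧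
    |(discreteState θ a b n (gridHits N h ω n)).2.2| ≤ (K * N (n * h) ω) ^ 2 := by
  have hK0 : 0 ≤ K := (add_nonneg (abs_nonneg a) (abs_nonneg b)).trans hK
  induction n with
  | zero => simp [discreteState, hN.zero]
  | succ n ih =>
    rw [discreteState_gridHits_succ]
    generalize discreteState θ a b n (gridHits N h ω n) = σ at ih
    obtain ⟨⟨hR0, hR1⟩, hW, hU⟩ := ih
    have hmono : N (n * h) ω ≤ N ((n + 1 : ℕ) * h) ω :=
      hN.mono ω (by push_cast; gcongr; simp)
    by_cases hB : N (n * h) ω < N ((n + 1 : ℕ) * h) ω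
    · have hw : |a + b * (θ * σ.1)| ≤ K := by
        have h2 : θ * σ.1 ≤ 1 := mul_le_one₀ hθ1 hR0 hR1
        calc |a + b * (θ * σ.1)| ≤ |a| + |b| * (θ * σ.1) := by
              refine (abs_add_le _ _).trans_eq ?_
              rw [abs_mul b, abs_of_nonneg (mul_nonneg hθ0 hR0)]
          _ ≤ |a| + |b| := by gcongr; exact mul_le_of_le_one_right (abs_nonneg _) h2
          _ ≤ K := hK
      have hc : (N (n * h) ω : ℝ) + 1 ≤ N ((n + 1 : ℕ) * h) ω := by exact_mod_cast hB
      simp only [discreteStep, hB, decide_true, if_true]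
      refine ⟨⟨zero_le_one, le_rfl⟩, ?_, ?_⟩
      · calc |σ.2.1 + (a + b * (θ * σ.1))| ≤ K * N (n * h) ω + K :=
            (abs_add_le _ _).trans (add_le_add hW hw)
          _ = K * (N (n * h) ω + 1) := by ring
          _ ≤ _ := by gcongr
      · calc |σ.2.2 + (a + b * (θ * σ.1)) * σ.2.1|
            ≤ (K * N (n * h) ω) ^ 2 + K * (K * N (n * h) ω) := by
              refine (abs_add_le _ _).trans (add_le_add hU ?_)
              rw [abs_mul]; gcongr
          _ ≤ (K * (N (n * h) ω + 1)) ^ 2 := by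
              have : 0 ≤ K ^ 2 * ((N (n * h) ω : ℝ) + 1) := by positivity
              nlinarith
          _ ≤ _ := by gcongr
    · simp only [discreteStep, hB, decide_false]
      refine ⟨⟨mul_nonneg hθ0 hR0, mul_le_one₀ hθ1 hR0 hR1⟩, ?_, ?_⟩
      · refine hW.trans ?_; gcongr
      · refine hU.trans ?_; gcongr

/-- If no cell holds two claims, the scheme is exact for the arrival times rounded up to the grid;
`R` then discounts the time since the last rounded arrival. -/
lemma IsClaimCountingProcess.discreteState_eq (hN : IsClaimCountingProcess N) (a b β : ℝ)
    {h : ℝ≥0} (hh : 0 < h) (n : ℕ)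
    (hfine : ∀ k < n, N ((k + 1 : ℕ) * h) ω ≤ N (k * h) ω + 1) :
    discreteState (Real.exp (-(β * h))) a b n (gridHits N h ω n) =
      (Real.exp (-(β * (n * h - h * ⌈arrivalTime N (N (n * h) ω) ω / h⌉₊))),
        ∑ i ∈ Finset.range (N (n * h) ω), gridWeight N a b β h i ω,
        ∑ j ∈ Finset.range (N (n * h) ω), gridWeight N a b β h j ω *
          ∑ i ∈ Finset.range j, gridWeight N a b β h i ω) := by
  induction n with
  | zero => simp [discreteState, hN.zero]
  | succ n ih =>
    rw [discreteState_gridHits_succ, ih fun k hk => hfine k (hk.trans n.lt_succ_self)]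
    have hmono : N (n * h) ω ≤ N ((n + 1 : ℕ) * h) ω :=
      hN.mono ω (by push_cast; gcongr; simp)
    have hexp : ∀ y : ℝ, Real.exp (-(β * h)) * Real.exp (-(β * (n * h - y))) =
        Real.exp (-(β * ((n + 1 : ℕ) * h - y))) := fun y => by
      rw [← Real.exp_add]; congr 1; push_cast; ring
    by_cases hB : N (n * h) ω < N ((n + 1 : ℕ) * h) ω
    · have heq : N ((n + 1 : ℕ) * h) ω = N (n * h) ω + 1 :=
        le_antisymm (hfine n n.lt_succ_self) hB
      -- The new claim lies in `(n h, (n + 1) h]` and is therefore rounded to `(n + 1) h`.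
      have hceil : ⌈arrivalTime N (N (n * h) ω + 1) ω / h⌉₊ = n + 1 := by
        rw [Nat.ceil_eq_iff n.succ_ne_zero]
        constructor
        · rw [Nat.succ_eq_add_one, Nat.add_sub_cancel, lt_div_iff₀ hh, ← not_le,
            hN.arrivalTime_le_iff (t := (n + 1 : ℕ) * h) heq.ge]
          simp
        · rw [div_le_iff₀ hh, hN.arrivalTime_le_iff (t := (n + 1 : ℕ) * h) heq.ge, heq]
      have hwt : a + b * (Real.exp (-(β * h)) * Real.exp
          (-(β * (n * h - h * ⌈arrivalTime N (N (n * h) ω) ω / h⌉₊)))) =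
          gridWeight N a b β h (N (n * h) ω) ω := by
        rw [hexp, gridWeight, hceil, mul_comm (h : ℝ) ((n + 1 : ℕ) : ℝ)]
      simp only [discreteStep, hwt, heq, Finset.sum_range_succ, hceil]
      simp [mul_comm]
    · have heq : N ((n + 1 : ℕ) * h) ω = N (n * h) ω := le_antisymm (not_lt.1 hB) hmono
      simp only [discreteStep, heq, hexp]
      simp

/-- Up to `t` there are finitely many claims, with positive gaps; once the mesh is below all gaps,
no cell holds two of them. -/
lemma IsClaimCountingProcess.eventually_fine (hN : IsClaimCountingProcess N) (t : ℝ≥0) (ω : Ω) :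
    ∀ᶠ n : ℕ in atTop, ∀ k < n,
      N ((k + 1 : ℕ) * (t / n)) ω ≤ N (k * (t / n)) ω + 1 := by
  have h2 : ∀ᶠ n : ℕ in atTop, ∀ i ∈ Finset.range (N t ω),
      arrivalTime N i ω + t / n < arrivalTime N (i + 1) ω := by
    rw [Finset.eventually_all]
    intro i hi
    have h3 := hN.arrivalTime_lt (Nat.lt_succ_self i) (Finset.mem_range.1 hi)
    have h4 : Tendsto (fun n : ℕ => arrivalTime N i ω + t / (n : ℝ≥0)) atTop
        (𝓝 (arrivalTime N i ω)) := by
      simpa only [add_zero] using (tendsto_mesh t).const_add (arrivalTime N i ω)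
    exact h4.eventually_lt_const h3
  filter_upwards [h2, eventually_gt_atTop 0] with n hn hn0 k hk
  by_contra! hlt
  set m := N (k * (t / n)) ω with hm
  have hle : N ((k + 1 : ℕ) * (t / n)) ω ≤ N t ω := by
    apply hN.mono ω
    calc ((k + 1 : ℕ) : ℝ≥0) * (t / n) ≤ n * (t / n) := by gcongr; exact_mod_cast hk
      _ = t := mul_div_cancel₀ _ (by positivity)
  have h5 := hn (m + 1) (Finset.mem_range.2 (by omega))
  have h6 : ¬ arrivalTime N (m + 1) ω ≤ k * (t / n) := by
    rw [hN.arrivalTime_le_iff (t := t) (by omega)]; omega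
  have h7 : arrivalTime N (m + 1 + 1) ω ≤ (k + 1 : ℕ) * (t / n) := by
    rw [hN.arrivalTime_le_iff (t := t) (by omega)]; omega
  have h8 : ((k + 1 : ℕ) : ℝ≥0) * (t / n) = k * (t / n) + t / n := by push_cast; ring
  have h9 := h5.trans_le h7
  rw [h8] at h9
  exact h6 (lt_of_add_lt_add_right h9).le

lemma IsClaimCountingProcess.tendsto_discreteState (hN : IsClaimCountingProcess N) (a b β : ℝ)
    (ht : 0 < t) (ω : Ω) :
    Tendsto (fun n : ℕ =>
      (discreteState (Real.exp (-(β * t / n))) a b n (gridHits N (t / n) ω n)).2.1) atTop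
      (𝓝 (∑ i ∈ Finset.range (N t ω), claimWeight N a b β i ω)) ∧
    Tendsto (fun n : ℕ =>
      (discreteState (Real.exp (-(β * t / n))) a b n (gridHits N (t / n) ω n)).2.2) atTop
      (𝓝 (∑ j ∈ Finset.range (N t ω), claimWeight N a b β j ω *
        ∑ i ∈ Finset.range j, claimWeight N a b β i ω)) := by
  have key : ∀ᶠ n : ℕ in atTop,
      discreteState (Real.exp (-(β * t / n))) a b n (gridHits N (t / n) ω n) =
      (Real.exp (-(β * (n * (t / n : ℝ≥0) -
          (t / n : ℝ≥0) * ⌈arrivalTime N (N t ω) ω / (t / n)⌉₊))),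
        ∑ i ∈ Finset.range (N t ω), gridWeight N a b β (t / n) i ω,
        ∑ j ∈ Finset.range (N t ω), gridWeight N a b β (t / n) j ω *
          ∑ i ∈ Finset.range j, gridWeight N a b β (t / n) i ω) := by
    filter_upwards [hN.eventually_fine t ω, eventually_gt_atTop 0] with n hn hn0
    have h1 : (n : ℝ≥0) * (t / n) = t := mul_div_cancel₀ _ (by positivity)
    have := hN.discreteState_eq a b β (h := t / n) (by positivity) n hn
    rw [h1] at this
    convert this using 3
    push_cast; ring
  have hw := tendsto_gridWeight N a b β ht (ω := ω)
  constructor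
  · refine (tendsto_finsetSum _ fun i _ => hw i).congr' ?_
    filter_upwards [key] with n hn
    rw [hn]
  · refine (tendsto_finsetSum _ fun j _ =>
      (hw j).mul (tendsto_finsetSum _ fun i _ => hw i)).congr' ?_
    filter_upwards [key] with n hn
    rw [hn]

end Paths

/-! ### Poisson moments -/

lemma measurable_poissonMeasure_singleton {f : ℝ≥0 → ℝ≥0} (hf : Measurable f) (k : ℕ) :
    Measurable fun l => poissonMeasure (f l) {k} := by
  simp only [poissonMeasure_singleton]
  fun_prop

lemma poissonMeasure_singleton_zero (r : ℝ≥0) :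
    poissonMeasure r {0} = ENNReal.ofReal (Real.exp (-r)) := by
  simp [poissonMeasure_singleton]

lemma poissonMeasure_compl_zero (r : ℝ≥0) :
    poissonMeasure r {0}ᶜ = ENNReal.ofReal (1 - Real.exp (-r)) := by
  rw [prob_compl_eq_one_sub (measurableSet_singleton 0), poissonMeasure_singleton_zero,
    ENNReal.ofReal_sub _ (Real.exp_pos _).le, ENNReal.ofReal_one]

/-- Shifting the index cancels one factor of the factorial and leaves `r` times the total mass; for
the square the same shift leaves `r` times mean plus mass. -/
lemma hasSum_poisson_mean (r : ℝ≥0) :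
    HasSum (fun n : ℕ => Real.exp (-r) * r ^ n / n.factorial * n) r := by
  rw [← hasSum_nat_add_iff' 1]
  have := (hasSum_one_poissonMeasure r).mul_left (r : ℝ)
  simp only [Finset.range_one, Finset.sum_singleton, Nat.cast_zero, mul_zero, sub_zero]
  rw [mul_one] at this
  refine this.congr_fun ?_
  intro n
  rw [Nat.factorial_succ]
  push_cast
  field_simp
  ring

lemma hasSum_poisson_sq (r : ℝ≥0) :
    HasSum (fun n : ℕ => Real.exp (-r) * r ^ n / n.factorial * (n : ℝ) ^ 2) (r ^ 2 + r) := by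
  rw [← hasSum_nat_add_iff' 1]
  have := ((hasSum_poisson_mean r).add (hasSum_one_poissonMeasure r)).mul_left (r : ℝ)
  simp only [Finset.range_one, Finset.sum_singleton, Nat.cast_zero, ne_eq, OfNat.ofNat_ne_zero,
    not_false_eq_true, zero_pow, mul_zero, sub_zero]
  rw [show (r : ℝ) * (r + 1) = r ^ 2 + r by ring] at this
  refine this.congr_fun ?_
  intro n
  rw [Nat.factorial_succ]
  push_cast
  field_simp
  ring

lemma lintegral_sq_poissonMeasure (r : ℝ≥0) :
    ∫⁻ k : ℕ, (k : ℝ≥0∞) ^ 2 ∂poissonMeasure r = ENNReal.ofReal (r ^ 2 + r) := by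
  rw [lintegral_countable', ← (hasSum_poisson_sq r).tsum_eq,
    ENNReal.ofReal_tsum_of_nonneg (fun n => by positivity) (hasSum_poisson_sq r).summable]
  refine tsum_congr fun k => ?_
  rw [poissonMeasure_singleton, ENNReal.ofReal_mul (by positivity), mul_comm]
  congr 1
  rw [ENNReal.ofReal_pow (by positivity), ENNReal.ofReal_natCast]

/-! ### Mixed Poisson arrivals and the moments of the weights -/

namespace IsMixedPoissonProcess

variable {Ω : Type*} [MeasurableSpace Ω] {μ : Measure Ω} {L : Measure ℝ≥0} {N : ℝ≥0 → Ω → ℕ}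

lemma measure_eq (hN : IsMixedPoissonProcess N L μ) (t : ℝ≥0) (k : ℕ) :
    μ {ω | N t ω = k} = ∫⁻ l, poissonMeasure (l * t) {k} ∂L := by
  have := hN.increments 1 ![0, t] (by
    intro i j hij
    fin_cases i <;> fin_cases j <;> simp_all) (fun _ => k)
  simpa [hN.zero] using this

lemma lintegral_comp (hN : IsMixedPoissonProcess N L μ) (t : ℝ≥0) (f : ℕ → ℝ≥0∞) :
    ∫⁻ ω, f (N t ω) ∂μ = ∫⁻ l, ∫⁻ k, f k ∂poissonMeasure (l * t) ∂L := by
  have hm := hN.measurable t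
  rw [← lintegral_map (μ := μ) (f := f) (g := N t) (by fun_prop) hm]
  simp only [lintegral_countable']
  rw [lintegral_tsum fun k =>
    ((measurable_poissonMeasure_singleton (by fun_prop) k).const_mul _).aemeasurable]
  refine tsum_congr fun k => ?_
  rw [lintegral_const_mul _ (measurable_poissonMeasure_singleton (by fun_prop) k),
    Measure.map_apply hm (measurableSet_singleton k), ← hN.measure_eq]
  rfl

lemma memLp_two (hN : IsMixedPoissonProcess N L μ) [IsProbabilityMeasure L]
    (hL : MemLp (fun l : ℝ≥0 => (l : ℝ)) 2 L) (t : ℝ≥0) :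
    MemLp (fun ω => (N t ω : ℝ)) 2 μ := by
  have hm : Measurable fun ω => (N t ω : ℝ) := measurable_from_nat.comp (hN.measurable t)
  rw [memLp_two_iff_integrable_sq hm.aestronglyMeasurable]
  refine ⟨(hm.pow_const 2).aestronglyMeasurable, ?_⟩
  have h1 : ∀ ω, ‖(N t ω : ℝ) ^ 2‖ₑ = (N t ω : ℝ≥0∞) ^ 2 := fun ω => by
    rw [← ofReal_norm, Real.norm_of_nonneg (by positivity),
      ENNReal.ofReal_pow (by positivity), ENNReal.ofReal_natCast]
  simp only [HasFiniteIntegral, h1]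
  rw [hN.lintegral_comp t fun k => (k : ℝ≥0∞) ^ 2]
  simp only [lintegral_sq_poissonMeasure]
  have hi : Integrable (fun l : ℝ≥0 => ((l * t : ℝ≥0) : ℝ) ^ 2 + ((l * t : ℝ≥0) : ℝ)) L := by
    simp only [NNReal.coe_mul, mul_pow]
    exact (hL.integrable_sq.mul_const _).add ((hL.integrable (by norm_num)).mul_const _)
  exact hi.lintegral_lt_top

lemma measurable_gridHits (hN : IsClaimCountingProcess N) (h : ℝ≥0) (n : ℕ) :
    Measurable fun ω => gridHits N h ω n := by
  refine measurable_pi_iff.2 fun i => ?_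
  have : Measurable fun p : ℕ × ℕ => decide (p.1 < p.2) := measurable_of_countable _
  exact this.comp ((hN.measurable _).prodMk (hN.measurable _))

/-- The increments over the cells have a mixture of product laws, and a hit pattern is a box for
them, each side being `{0}` or its complement. Summing over the countably many points of the box
commutes with the mixing. -/
lemma measureReal_gridHits (hN : IsMixedPoissonProcess N L μ) (h : ℝ≥0) (n : ℕ)
    (ε : Fin n → Bool) :
    μ.real {ω | gridHits N h ω n = ε} =
      ∫ l : ℝ≥0, ∏ i, (if ε i then 1 - Real.exp (-(l * h)) else Real.exp (-(l * h))) ∂L := by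
  let ξ : Ω → Fin n → ℕ := fun ω i => N (((i : ℕ) + 1 : ℕ) * h) ω - N ((i : ℕ) * h) ω
  have hmono : ∀ ω (i : ℕ), N (i * h) ω ≤ N ((i + 1 : ℕ) * h) ω := fun ω i =>
    hN.mono ω (by push_cast; gcongr; simp)
  have hξ : Measurable ξ := measurable_pi_iff.2 fun i => by
    have : Measurable fun p : ℕ × ℕ => p.1 - p.2 := measurable_of_countable _
    exact this.comp ((hN.measurable _).prodMk (hN.measurable _))
  have hlaw : ∀ k : Fin n → ℕ, μ.map ξ {k} = ∫⁻ l, ∏ i, poissonMeasure (l * h) {k i} ∂L := by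
    intro k
    rw [Measure.map_apply hξ (measurableSet_singleton k)]
    have := hN.increments n (fun i => (i : ℕ) * h)
      (fun i j hij => by
        have : ((i : ℕ) : ℝ≥0) ≤ (j : ℕ) := by exact_mod_cast hij
        dsimp only; gcongr) k
    have hd : ∀ i : Fin n, ((i.succ : ℕ) : ℝ≥0) * h - ((i.castSucc : ℕ) : ℝ≥0) * h = h :=
        fun i => by
      simp [add_mul]
    simp only [hd] at this
    rw [← this]
    congr 1
    ext ω
    simp only [Set.mem_preimage, Set.mem_singleton_iff, funext_iff, ξ, Set.mem_ofPred_eq,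
      Fin.val_succ, Fin.val_castSucc]
    refine forall_congr' fun i => ?_
    have := hmono ω i
    omega
  let A : Fin n → Set ℕ := fun i => if ε i then {0}ᶜ else {0}
  have hset : {ω | gridHits N h ω n = ε} = ξ ⁻¹' (Set.univ.pi A) := by
    ext ω
    simp only [Set.mem_ofPred_eq, funext_iff, gridHits, Set.mem_preimage, Set.mem_univ_pi, A, ξ]
    refine forall_congr' fun i => ?_
    have := hmono ω i
    by_cases hε : ε i
    · simp only [hε, if_true, decide_eq_true_eq, Set.mem_compl_iff, Set.mem_singleton_iff]
      omega
    · simp only [hε, decide_eq_false_iff_not, Bool.false_eq_true, if_false,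
        Set.mem_singleton_iff]
      omega
  have hμ : μ {ω | gridHits N h ω n = ε} = ∫⁻ l, ∏ i, poissonMeasure (l * h) (A i) ∂L := by
    rw [hset, ← Measure.map_apply hξ (MeasurableSet.of_discrete),
      ← Measure.tsum_indicator_apply_singleton _ _ MeasurableSet.of_discrete]
    -- For a fixed rate the box has product-measure probability, expanded over its points.
    have h1 : ∀ l, ∏ i, poissonMeasure (l * h) (A i) = ∑' k : Fin n → ℕ,
        (Set.univ.pi A).indicator (fun k => ∏ i, poissonMeasure (l * h) {k i}) k := fun l => by
      rw [← Measure.pi_pi, ← Measure.tsum_indicator_apply_singleton _ _ MeasurableSet.of_discrete]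
      refine tsum_congr fun k => ?_
      simp only [Set.indicator, Measure.pi_singleton]
    simp only [h1]
    have hm : ∀ k : Fin n → ℕ, Measurable fun l => ∏ i, poissonMeasure (l * h) {k i} := fun k =>
      Finset.measurable_fun_prod _ fun i _ => measurable_poissonMeasure_singleton (by fun_prop) _
    rw [lintegral_tsum]
    · refine tsum_congr fun k => ?_
      by_cases hk : k ∈ Set.univ.pi A
      · simp only [Set.indicator_of_mem hk, hlaw]
      · simp only [Set.indicator_of_notMem hk, lintegral_zero]
    · intro k
      by_cases hk : k ∈ Set.univ.pi A
      · simpa only [Set.indicator_of_mem hk] using (hm k).aemeasurable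
      · simp only [Set.indicator_of_notMem hk]; fun_prop
  have he : ∀ l : ℝ≥0, 0 ≤ 1 - Real.exp (-(l * h : ℝ)) := fun l => by
    rw [sub_nonneg, Real.exp_le_one_iff, neg_nonpos]; positivity
  have hnn : ∀ (l : ℝ≥0) (i : Fin n), 0 ≤ (if ε i then 1 - Real.exp (-(l * h : ℝ))
      else Real.exp (-(l * h : ℝ))) := fun l i => by
    split_ifs
    exacts [he l, (Real.exp_pos _).le]
  rw [integral_eq_lintegral_of_nonneg_ae
    (Eventually.of_forall fun l => Finset.prod_nonneg fun i _ => hnn l i), measureReal_def, hμ]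
  · congr 2
    ext l
    rw [ENNReal.ofReal_prod_of_nonneg fun i _ => hnn l i]
    refine Finset.prod_congr rfl fun i _ => ?_
    simp only [A]
    split_ifs
    · rw [poissonMeasure_compl_zero]; simp
    · rw [poissonMeasure_singleton_zero]; simp
  · refine (Finset.measurable_fun_prod _ fun i _ => ?_).aestronglyMeasurable
    split_ifs <;> fun_prop

variable [IsProbabilityMeasure μ] [IsProbabilityMeasure L]

lemma integral_discreteState (hN : IsMixedPoissonProcess N L μ) (h : ℝ≥0) (θ a b : ℝ) (n : ℕ)
    (f : ℝ × ℝ × ℝ → ℝ) :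
    ∫ ω, f (discreteState θ a b n (gridHits N h ω n)) ∂μ =
      ∫ l : ℝ≥0, discreteMean (1 - Real.exp (-(l * h))) θ a b n f ∂L := by
  have hY := measurable_gridHits hN.toIsClaimCountingProcess h n
  rw [← integral_map (μ := μ) (φ := fun ω => gridHits N h ω n)
    (f := fun ε => f (discreteState θ a b n ε)) hY.aemeasurable
    (measurable_of_finite _).aestronglyMeasurable]
  have := Measure.isProbabilityMeasure_map (μ := μ) hY.aemeasurable
  rw [integral_fintype .of_finite]
  unfold discreteMean
  have hi : ∀ ε : Fin n → Bool, Integrable (fun l : ℝ≥0 => ∏ i,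
      (if ε i then 1 - Real.exp (-(l * h : ℝ)) else 1 - (1 - Real.exp (-(l * h : ℝ))))) L := by
    intro ε
    refine Integrable.of_bound (C := 1)
      (Finset.measurable_fun_prod _ fun i _ => ?_).aestronglyMeasurable
      (Eventually.of_forall fun l => ?_)
    · split_ifs <;> fun_prop
    · rw [norm_prod]
      refine Finset.prod_le_one (fun _ _ => norm_nonneg _) fun i _ => ?_
      have h1 : Real.exp (-(l * h : ℝ)) ≤ 1 := by
        rw [Real.exp_le_one_iff, neg_nonpos]; positivity
      have h2 := Real.exp_pos (-(l * h : ℝ))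
      rw [Real.norm_eq_abs, abs_le]
      split_ifs <;> constructor <;> linarith
  rw [integral_finsetSum _ fun ε _ => (hi ε).mul_const _]
  refine Finset.sum_congr rfl fun ε _ => ?_
  rw [integral_mul_const, smul_eq_mul, map_measureReal_apply hY (measurableSet_singleton ε)]
  congr 1
  simp only [sub_sub_cancel]
  exact hN.measureReal_gridHits h n ε

lemma measurable_discreteMean (h : ℝ≥0) (θ a b : ℝ) (n : ℕ) (f : ℝ × ℝ × ℝ → ℝ) :
    Measurable fun l : ℝ≥0 => discreteMean (1 - Real.exp (-(l * h))) θ a b n f := by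
  unfold discreteMean
  refine Finset.measurable_fun_sum _ fun ε _ => Measurable.mul_const ?_ _
  refine Finset.measurable_fun_prod _ fun i _ => ?_
  split_ifs <;> fun_prop

/-- The first two moments of the sum of the weights of the claims, for mixed Poisson arrivals. -/
theorem integral_sum_claimWeight (hN : IsMixedPoissonProcess N L μ)
    (hL : MemLp (fun l : ℝ≥0 => (l : ℝ)) 2 L) (a b : ℝ) {β : ℝ} (hβ : 0 ≤ β) {t : ℝ≥0}
    (ht : 0 < t) :
    (∫ ω, ∑ i ∈ Finset.range (N t ω), claimWeight N a b β i ω ∂μ =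
      ∫ l : ℝ≥0, firstMoment a b β t l ∂L) ∧
    (∫ ω, ∑ j ∈ Finset.range (N t ω), claimWeight N a b β j ω *
        ∑ i ∈ Finset.range j, claimWeight N a b β i ω ∂μ =
      ∫ l : ℝ≥0, secondMoment a b β t l ∂L) := by
  have hN' := hN.toIsClaimCountingProcess
  set K := |a| + |b| with hK
  have hK0 : 0 ≤ K := by positivity
  have hNL := hN.memLp_two hL t
  have hθ0 : ∀ n : ℕ, 0 ≤ Real.exp (-(β * t / n)) := fun n => (Real.exp_pos _).le
  have hθ1 : ∀ n : ℕ, Real.exp (-(β * t / n)) ≤ 1 := fun n => by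
    rw [Real.exp_le_one_iff, neg_nonpos]; positivity
  have hp1 : ∀ (l : ℝ≥0) (n : ℕ), 1 - Real.exp (-(l * t / n : ℝ)) ≤ 1 := fun l n => by
    linarith [Real.exp_pos (-(l * t / n : ℝ))]
  have hp0 : ∀ (l : ℝ≥0) (n : ℕ), 0 ≤ 1 - Real.exp (-(l * t / n : ℝ)) := fun l n => by
    rw [sub_nonneg, Real.exp_le_one_iff, neg_nonpos]; positivity
  have hnp : ∀ (l : ℝ≥0) (n : ℕ), n * (1 - Real.exp (-(l * t / n : ℝ))) ≤ l * t := fun l n => by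
    rcases n.eq_zero_or_pos with rfl | hn
    · simp; positivity
    · have h1 := Real.add_one_le_exp (-(l * t / n : ℝ))
      calc n * (1 - Real.exp (-(l * t / n : ℝ))) ≤ n * (l * t / n) := by gcongr; linarith
        _ = l * t := by field_simp
  have hNle : ∀ (n : ℕ) ω, (N (n * (t / n)) ω : ℝ) ≤ N t ω := fun n ω => by
    refine Nat.cast_le.2 (hN.mono ω ?_)
    rcases n.eq_zero_or_pos with rfl | hn
    · simp
    · exact (mul_div_cancel₀ t (by positivity)).le
  have hcast : ∀ (l : ℝ≥0) (n : ℕ), (l : ℝ) * ((t / n : ℝ≥0) : ℝ) = l * t / n := fun l n => by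
    push_cast; ring
  have hrec := fun (l : ℝ≥0) (n : ℕ) => isMomentRecursion_discreteMean
    (1 - Real.exp (-(l * t / n : ℝ))) (Real.exp (-(β * t / n))) a b
  have hlim := fun l : ℝ≥0 => tendsto_discrete_moments (t := (t : ℝ)) hβ l.2 _ _ _ _ (hrec l)
    (by exact_mod_cast ht)
  have hmeas : ∀ (n : ℕ) (f : ℝ × ℝ × ℝ → ℝ), AEStronglyMeasurable (fun ω =>
      f (discreteState (Real.exp (-(β * t / n))) a b n (gridHits N (t / n) ω n))) μ := fun n f =>
    ((measurable_of_finite fun ε => f (discreteState (Real.exp (-(β * t / n))) a b n ε)).comp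
      (measurable_gridHits hN' (t / n) n)).aestronglyMeasurable
  have hmeasL : ∀ (n : ℕ) (f : ℝ × ℝ × ℝ → ℝ), AEStronglyMeasurable (fun l : ℝ≥0 =>
      discreteMean (1 - Real.exp (-(l * t / n : ℝ))) (Real.exp (-(β * t / n))) a b n f) L :=
    fun n f => by
      simp only [← hcast]
      exact (measurable_discreteMean _ _ _ _ _ _).aestronglyMeasurable
  have hint : ∀ (n : ℕ) (f : ℝ × ℝ × ℝ → ℝ), ∫ ω,
      f (discreteState (Real.exp (-(β * t / n))) a b n (gridHits N (t / n) ω n)) ∂μ =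
      ∫ l : ℝ≥0, discreteMean (1 - Real.exp (-(l * t / n : ℝ)))
        (Real.exp (-(β * t / n))) a b n f ∂L := fun n f => by
    rw [hN.integral_discreteState]; simp only [hcast]
  have hLi : Integrable (fun l : ℝ≥0 => (l : ℝ)) L := hL.integrable (by norm_num)
  constructor
  -- The same sequence of integrals has two limits: along the paths, dominated by `K N(t)`, and
  -- after rewriting over `L`, dominated by `K l t`. The second moment is treated alike with the
  -- squares of these bounds.
  · refine tendsto_nhds_unique (tendsto_integral_of_dominated_convergence
      (fun ω => K * (N t ω : ℝ)) (fun n => hmeas n fun σ => σ.2.1)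
      ((hNL.integrable (by norm_num)).const_mul K) (fun n => Eventually.of_forall fun ω => ?_)
      (Eventually.of_forall fun ω => (hN'.tendsto_discreteState a b β ht ω).1)) ?_
    · refine (hN'.discreteState_bound (hθ0 n) (hθ1 n) hK.ge _ n).2.1.trans ?_
      exact mul_le_mul_of_nonneg_left (hNle n ω) hK0
    · simp only [hint _ fun σ => σ.2.1]
      refine tendsto_integral_of_dominated_convergence (fun l : ℝ≥0 => K * ((l : ℝ) * t))
        (fun n => hmeasL n fun σ => σ.2.1) ((hLi.mul_const _).const_mul K)
        (fun n => Eventually.of_forall fun l => ?_)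
        (Eventually.of_forall fun l => (hlim l).1)
      refine ((hrec l n).abs_w_le (hp0 l n) (hp1 l n) (hθ0 n) (hθ1 n) hK.ge n).trans ?_
      exact mul_le_mul_of_nonneg_left (hnp l n) hK0
  · refine tendsto_nhds_unique (tendsto_integral_of_dominated_convergence
      (fun ω => K ^ 2 * (N t ω : ℝ) ^ 2) (fun n => hmeas n fun σ => σ.2.2)
      (hNL.integrable_sq.const_mul _) (fun n => Eventually.of_forall fun ω => ?_)
      (Eventually.of_forall fun ω => (hN'.tendsto_discreteState a b β ht ω).2)) ?_
    · refine (hN'.discreteState_bound (hθ0 n) (hθ1 n) hK.ge _ n).2.2.trans ?_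
      rw [← mul_pow]
      exact pow_le_pow_left₀ (by positivity) (mul_le_mul_of_nonneg_left (hNle n ω) hK0) 2
    · simp only [hint _ fun σ => σ.2.2]
      refine tendsto_integral_of_dominated_convergence
        (fun l : ℝ≥0 => K ^ 2 * ((l : ℝ) ^ 2 * t ^ 2))
        (fun n => hmeasL n fun σ => σ.2.2) ((hL.integrable_sq.mul_const _).const_mul _)
        (fun n => Eventually.of_forall fun l => ?_)
        (Eventually.of_forall fun l => (hlim l).2)
      refine ((hrec l n).abs_u_le (hp0 l n) (hp1 l n) (hθ0 n) (hθ1 n) hK.ge n).trans ?_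
      rw [← mul_pow, ← mul_pow]
      exact pow_le_pow_left₀ (mul_nonneg hK0 (mul_nonneg (Nat.cast_nonneg n) (hp0 l n)))
        (mul_le_mul_of_nonneg_left (hnp l n) hK0) 2

end IsMixedPoissonProcess

/-! ### Auxiliary measure theory -/

/-- The one-dimensional criterion is applied twice, to the marginals of the measures restricted to a
strip: first with `Iic y` fixed, then with an arbitrary measurable first factor. -/
lemma MeasureTheory.Measure.ext_of_Iic_prod_Iic {ρ ν : Measure (ℝ × ℝ)} [IsFiniteMeasure ρ]
    (h : ∀ x y, ρ (Set.Iic x ×ˢ Set.Iic y) = ν (Set.Iic x ×ˢ Set.Iic y)) : ρ = ν := by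
  have h1 : ∀ (s : Set ℝ), MeasurableSet s → ∀ y,
      ρ (s ×ˢ Set.Iic y) = ν (s ×ˢ Set.Iic y) := by
    intro s hs y
    have hr : ∀ (τ : Measure (ℝ × ℝ)) (s : Set ℝ), MeasurableSet s →
        (τ.restrict (Set.univ ×ˢ Set.Iic y)).map Prod.fst s = τ (s ×ˢ Set.Iic y) := by
      intro τ s hs
      rw [Measure.map_apply measurable_fst hs, Measure.restrict_apply (measurable_fst hs)]
      congr 1; ext; simp
    rw [← hr ρ s hs, ← hr ν s hs]
    congr 1
    refine Measure.ext_of_Iic _ _ fun x => ?_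
    rw [hr _ _ measurableSet_Iic, hr _ _ measurableSet_Iic, h]
  refine Measure.ext_prod fun {s t} hs ht => ?_
  have hr : ∀ (τ : Measure (ℝ × ℝ)) (t : Set ℝ), MeasurableSet t →
      (τ.restrict (s ×ˢ Set.univ)).map Prod.snd t = τ (s ×ˢ t) := by
    intro τ t ht
    rw [Measure.map_apply measurable_snd ht, Measure.restrict_apply (measurable_snd ht)]
    congr 1; ext; simp [and_comm]
  rw [← hr ρ t ht, ← hr ν t ht]
  congr 1
  refine Measure.ext_of_Iic _ _ fun y => ?_
  rw [hr _ _ measurableSet_Iic, hr _ _ measurableSet_Iic, h1 s hs]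

lemma sum_integral_mul_const {Ω : Type*} [MeasurableSpace Ω] {μ : Measure Ω}
    {f₁ f₂ f₃ f₄ : Ω → ℝ} (h₁ : Integrable f₁ μ) (h₂ : Integrable f₂ μ) (h₃ : Integrable f₃ μ)
    (h₄ : Integrable f₄ μ) (c₁ c₂ c₃ c₄ : ℝ) :
    (∫ ω, f₁ ω ∂μ) * c₁ + (∫ ω, f₂ ω ∂μ) * c₂ + (∫ ω, f₃ ω ∂μ) * c₃ + (∫ ω, f₄ ω ∂μ) * c₄ =
      ∫ ω, (f₁ ω * c₁ + f₂ ω * c₂ + f₃ ω * c₃ + f₄ ω * c₄) ∂μ := by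
  have i₁ := h₁.mul_const c₁
  have i₂ := h₂.mul_const c₂
  have i₃ := h₃.mul_const c₃
  rw [integral_add ((i₁.fun_add i₂).fun_add i₃) (h₄.mul_const c₄),
    integral_add (i₁.fun_add i₂) i₃, integral_add i₁ i₂]
  simp only [integral_mul_const]

lemma measurable_comp_natIndex {Ω : Type*} [MeasurableSpace Ω] {F : ℕ → Ω → ℝ} {M : Ω → ℕ}
    (hF : ∀ n, Measurable (F n)) (hM : Measurable M) : Measurable fun ω => F (M ω) ω := by
  have : Measurable fun p : Ω × ℕ => F p.2 p.1 := measurable_from_prod_countable_left hF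
  exact this.comp (measurable_id.prodMk hM)

/-! ### Measurability and integrability of the claim weights -/

section Arrivals

variable {Ω : Type*} [MeasurableSpace Ω] {N : ℝ≥0 → Ω → ℕ}

namespace IsClaimCountingProcess

lemma arrivalSigma_le (hN : IsClaimCountingProcess N) :
    arrivalSigma N ≤ (inferInstance : MeasurableSpace Ω) :=
  iSup_le fun t => (hN.measurable t).comap_le

lemma measurable_arrivalTime (hN : IsClaimCountingProcess N) (i : ℕ) :
    Measurable (arrivalTime N i) := by
  refine measurable_of_Iic fun s => ?_
  -- If fewer than `i` claims ever arrive, the arrival time is `sInf ∅ = 0`. By monotonicity this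
  -- event is tested at integer times.
  have : arrivalTime N i ⁻¹' Set.Iic s =
      {ω | i ≤ N s ω} ∪ ⋂ k : ℕ, {ω | N k ω < i} := by
    ext ω
    simp only [Set.mem_preimage, Set.mem_Iic, Set.mem_union, Set.mem_ofPred_eq, Set.mem_iInter]
    by_cases h : ∃ t, i ≤ N t ω
    · obtain ⟨t, ht⟩ := h
      rw [hN.arrivalTime_le_iff ht]
      obtain ⟨k, hk⟩ := exists_nat_ge t
      have := ht.trans (hN.mono ω hk)
      refine ⟨Or.inl, fun h => h.resolve_right fun h' => ?_⟩
      exact absurd (h' k) (not_lt.2 this)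
    · push Not at h
      have h0 : {t : ℝ≥0 | i ≤ N t ω} = ∅ := by
        ext t; simpa using h t
      simp [arrivalTime, h0, h]
  rw [this]
  exact ((hN.measurable s) (.of_discrete (s := Set.Ici i))).union
    (MeasurableSet.iInter fun k => (hN.measurable k) (.of_discrete (s := Set.Iio i)))

lemma measurable_interClaimTime (hN : IsClaimCountingProcess N) (i : ℕ) :
    Measurable (interClaimTime N i) :=
  (hN.measurable_arrivalTime i).coe_nnreal_real.sub
    (hN.measurable_arrivalTime (i - 1)).coe_nnreal_real

lemma measurable_claimWeight (hN : IsClaimCountingProcess N) (a b β : ℝ) (i : ℕ) :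
    Measurable (claimWeight N a b β i) := by
  have := hN.measurable_interClaimTime (i + 1)
  unfold claimWeight
  fun_prop

lemma abs_claimWeight_le (hN : IsClaimCountingProcess N) (a b : ℝ) {β : ℝ} (hβ : 0 ≤ β) {i : ℕ}
    {t : ℝ≥0} {ω : Ω} (hi : i < N t ω) : |claimWeight N a b β i ω| ≤ |a| + |b| := by
  have h1 : Real.exp (-(β * interClaimTime N (i + 1) ω)) ≤ 1 := by
    rw [Real.exp_le_one_iff, neg_nonpos]
    exact mul_nonneg hβ (hN.interClaimTime_nonneg hi)
  unfold claimWeight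
  refine (abs_add_le _ _).trans ?_
  rw [abs_mul, Real.abs_exp]
  gcongr
  exact mul_le_of_le_one_right (abs_nonneg _) h1

variable {μ : Measure Ω}

lemma integrable_sum_claimWeight (hN : IsClaimCountingProcess N) (a b : ℝ) {β : ℝ} (hβ : 0 ≤ β)
    {t : ℝ≥0} (hNt : Integrable (fun ω => (N t ω : ℝ)) μ) :
    Integrable (fun ω => ∑ i ∈ Finset.range (N t ω), claimWeight N a b β i ω) μ := by
  refine (hNt.const_mul (|a| + |b|)).mono' (measurable_comp_natIndex
    (F := fun n ω => ∑ i ∈ Finset.range n, claimWeight N a b β i ω) (fun n =>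
      Finset.measurable_fun_sum _ fun i _ => hN.measurable_claimWeight a b β i)
    (hN.measurable t)).aestronglyMeasurable (Eventually.of_forall fun ω => ?_)
  refine (Finset.abs_sum_le_sum_abs _ _).trans ((Finset.sum_le_card_nsmul _ _ _ fun i hi =>
    hN.abs_claimWeight_le a b hβ (Finset.mem_range.1 hi)).trans_eq ?_)
  rw [Finset.card_range, nsmul_eq_mul, mul_comm]

lemma integrable_sum_mul_claimWeight (hN : IsClaimCountingProcess N) (a b : ℝ) {β : ℝ}
    (hβ : 0 ≤ β) {t : ℝ≥0} (hNt : Integrable (fun ω => (N t ω : ℝ) ^ 2) μ) :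
    Integrable (fun ω => ∑ j ∈ Finset.range (N t ω), claimWeight N a b β j ω *
        ∑ i ∈ Finset.range j, claimWeight N a b β i ω) μ := by
  refine (hNt.const_mul ((|a| + |b|) ^ 2)).mono' (measurable_comp_natIndex
    (F := fun n ω => ∑ j ∈ Finset.range n, claimWeight N a b β j ω *
        ∑ i ∈ Finset.range j, claimWeight N a b β i ω) (fun n =>
      Finset.measurable_fun_sum _ fun j _ => (hN.measurable_claimWeight a b β j).mul
        (Finset.measurable_fun_sum _ fun i _ => hN.measurable_claimWeight a b β i))
    (hN.measurable t)).aestronglyMeasurable (Eventually.of_forall fun ω => ?_)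
  have hK0 : 0 ≤ |a| + |b| := by positivity
  refine (Finset.abs_sum_le_sum_abs _ _).trans ((Finset.sum_le_card_nsmul _ _
    ((|a| + |b|) * ((|a| + |b|) * N t ω)) fun j hj => ?_).trans_eq ?_)
  · rw [Finset.mem_range] at hj
    rw [abs_mul]
    refine mul_le_mul (hN.abs_claimWeight_le a b hβ hj) ?_ (abs_nonneg _) hK0
    refine (Finset.abs_sum_le_sum_abs _ _).trans ((Finset.sum_le_card_nsmul _ _ _ fun i hi =>
      hN.abs_claimWeight_le a b hβ ((Finset.mem_range.1 hi).trans hj)).trans ?_)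
    rw [Finset.card_range, nsmul_eq_mul, mul_comm]
    gcongr
  · rw [Finset.card_range, nsmul_eq_mul]; ring

end IsClaimCountingProcess

end Arrivals

lemma claimCdf_mem {β v : ℝ} (hβ : 0 ≤ β) (hv : 0 ≤ v) (Hl Hs : Measure ℝ) (y : ℝ) :
    0 ≤ claimCdf β Hl Hs v y ∧ claimCdf β Hl Hs v y ≤ 1 := by
  have h0 := Real.exp_pos (-(β * v))
  have h1 : Real.exp (-(β * v)) ≤ 1 := by
    rw [Real.exp_le_one_iff, neg_nonpos]; exact mul_nonneg hβ hv
  have := cdf_nonneg Hl y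
  have := cdf_nonneg Hs y
  have := cdf_le_one Hl y
  have := cdf_le_one Hs y
  unfold claimCdf
  constructor
  · have : 0 ≤ 1 - Real.exp (-(β * v)) := by linarith
    positivity
  · nlinarith

lemma tendsto_claimCdf_atTop (β v : ℝ) (Hl Hs : Measure ℝ) :
    Tendsto (claimCdf β Hl Hs v) atTop (𝓝 1) := by
  have := ((tendsto_cdf_atTop Hl).const_mul (1 - Real.exp (-(β * v)))).add
    ((tendsto_cdf_atTop Hs).const_mul (Real.exp (-(β * v))))
  simpa [claimCdf] using! this

/-! ### Laws of one and of two claims on an arrival event -/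

namespace IsClaimSizes

variable {Ω : Type*} [MeasurableSpace Ω] {μ : Measure Ω} [IsProbabilityMeasure μ]
  {N : ℝ≥0 → Ω → ℕ} {X : ℕ → Ω → ℝ} {β : ℝ} {Hl Hs : Measure ℝ} {n i j : ℕ} {A : Set Ω}

/-- `condLaw` constrains the first `n` claims all at once; a subfamily is reached by sending the
other thresholds to infinity, where the conditional cdfs tend to `1`. -/
lemma measureReal_inter (hX : IsClaimSizes X N β Hl Hs μ) (hN : IsClaimCountingProcess N)
    (hβ : 0 ≤ β) (hA : MeasurableSet[arrivalSigma N] A) (hAn : ∀ ω ∈ A, ∃ t, n ≤ N t ω)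
    {s : Finset ℕ} (hs : s ⊆ Finset.Icc 1 n) (y : ℕ → ℝ) :
    μ.real (A ∩ {ω | ∀ i ∈ s, X i ω ≤ y i}) =
      ∫ ω in A, ∏ i ∈ s, claimCdf β Hl Hs (interClaimTime N i ω) (y i) ∂μ := by
  have hA' : MeasurableSet A := hN.arrivalSigma_le _ hA
  have hset : ∀ (s : Finset ℕ) (y : ℕ → ℝ), MeasurableSet {ω | ∀ i ∈ s, X i ω ≤ y i} := by
    intro s y
    have : {ω | ∀ i ∈ s, X i ω ≤ y i} = ⋂ i ∈ s, {ω | X i ω ≤ y i} := by ext; simp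
    rw [this]
    exact Finset.measurableSet_biInter _ fun i _ =>
      measurableSet_le (hX.measurable i) measurable_const
  have hfull : ∀ y : ℕ → ℝ, μ.real (A ∩ {ω | ∀ i ∈ Finset.Icc 1 n, X i ω ≤ y i}) =
      ∫ ω in A, ∏ i ∈ Finset.Icc 1 n, claimCdf β Hl Hs (interClaimTime N i ω) (y i) ∂μ := by
    intro y
    have h1 := setIntegral_condExp (μ := μ) hN.arrivalSigma_le
      (f := Set.indicator {ω | ∀ i ∈ Finset.Icc 1 n, X i ω ≤ y i} fun _ => (1 : ℝ))
      ((integrable_const 1).indicator (hset _ y)) hA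
    rw [setIntegral_indicator (hset _ y), setIntegral_const, smul_eq_mul, mul_one] at h1
    rw [← h1]
    refine setIntegral_congr_ae hA' ?_
    filter_upwards [hX.condLaw n y] with ω hω hωA using hω (hAn ω hωA)
  -- Thresholds outside `s` are set to `m` and then released by `m → ∞`.
  let z : ℕ → ℕ → ℝ := fun m i => if i ∈ s then y i else m
  have hnn : ∀ ω ∈ A, ∀ i ∈ Finset.Icc 1 n, 0 ≤ interClaimTime N i ω := fun ω hω i hi => by
    obtain ⟨t, ht⟩ := hAn ω hω
    exact hN.interClaimTime_nonneg ((Finset.mem_Icc.1 hi).2.trans ht)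
  have hR : Tendsto (fun m : ℕ => ∫ ω in A,
      ∏ i ∈ Finset.Icc 1 n, claimCdf β Hl Hs (interClaimTime N i ω) (z m i) ∂μ) atTop
      (𝓝 (∫ ω in A, ∏ i ∈ s, claimCdf β Hl Hs (interClaimTime N i ω) (y i) ∂μ)) := by
    refine tendsto_integral_of_dominated_convergence (fun _ => 1) (fun m => ?_)
      (integrable_const 1) (fun m => ?_) (Eventually.of_forall fun ω => ?_)
    · refine (Finset.measurable_fun_prod _ fun i _ => ?_).aestronglyMeasurable
      have := hN.measurable_interClaimTime i
      unfold claimCdf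
      fun_prop
    · refine ae_restrict_of_forall_mem hA' fun ω hω => ?_
      rw [norm_prod]
      refine Finset.prod_le_one (fun _ _ => norm_nonneg _) fun i hi => ?_
      have := claimCdf_mem hβ (hnn ω hω i hi) Hl Hs (z m i)
      rw [Real.norm_of_nonneg this.1]
      exact this.2
    · have : ∏ i ∈ s, claimCdf β Hl Hs (interClaimTime N i ω) (y i) =
          ∏ i ∈ Finset.Icc 1 n,
            if i ∈ s then claimCdf β Hl Hs (interClaimTime N i ω) (y i) else 1 := by
        rw [Finset.prod_ite_mem, Finset.inter_eq_right.2 hs]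
      rw [this]
      refine tendsto_finsetProd _ fun i _ => ?_
      by_cases hi : i ∈ s
      · simp only [z, hi, if_true]; exact tendsto_const_nhds
      · simp only [z, hi, if_false]
        exact (tendsto_claimCdf_atTop _ _ _ _).comp tendsto_natCast_atTop_atTop
  have hLim : Tendsto (fun m : ℕ => μ.real (A ∩ {ω | ∀ i ∈ Finset.Icc 1 n, X i ω ≤ z m i})) atTop
      (𝓝 (μ.real (A ∩ {ω | ∀ i ∈ s, X i ω ≤ y i}))) := by
    have hU : A ∩ {ω | ∀ i ∈ s, X i ω ≤ y i} =
        ⋃ m : ℕ, A ∩ {ω | ∀ i ∈ Finset.Icc 1 n, X i ω ≤ z m i} := by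
      rw [← Set.inter_iUnion]
      congr 1
      ext ω
      simp only [Set.mem_ofPred_eq, Set.mem_iUnion]
      constructor
      · intro h
        obtain ⟨m, hm⟩ := exists_nat_ge (∑ i ∈ Finset.Icc 1 n, |X i ω|)
        refine ⟨m, fun i hi => ?_⟩
        by_cases his : i ∈ s
        · simp only [z, his, if_true]; exact h i his
        · simp only [z, his, if_false]
          exact (le_abs_self _).trans ((Finset.single_le_sum
            (f := fun i => |X i ω|) (fun i _ => abs_nonneg _) hi).trans hm)
      · rintro ⟨m, hm⟩ i hi
        simpa only [z, hi, if_true] using hm i (hs hi)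
    rw [hU]
    refine (ENNReal.tendsto_toReal (measure_ne_top _ _)).comp
      (tendsto_measure_iUnion_atTop ?_)
    intro m m' hmm
    refine Set.inter_subset_inter_right _ fun ω hω i hi => (hω i hi).trans ?_
    simp only [z]
    split_ifs
    · exact le_rfl
    · exact_mod_cast hmm
  simp only [hfull] at hLim
  exact tendsto_nhds_unique hLim hR

variable [IsProbabilityMeasure Hl] [IsProbabilityMeasure Hs]

lemma exp_mem (hN : IsClaimCountingProcess N) (hβ : 0 ≤ β)
    (hAn : ∀ ω ∈ A, ∃ t, n ≤ N t ω) (hi : i ≤ n) :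
    ∀ ω ∈ A, 0 ≤ Real.exp (-(β * interClaimTime N i ω)) ∧
      Real.exp (-(β * interClaimTime N i ω)) ≤ 1 := fun ω hω => by
  obtain ⟨t, ht⟩ := hAn ω hω
  refine ⟨(Real.exp_pos _).le, ?_⟩
  rw [Real.exp_le_one_iff, neg_nonpos]
  exact mul_nonneg hβ (hN.interClaimTime_nonneg (hi.trans ht))

/-- The conditional cdf is affine in `exp (-β V)`, so integrating it over `A` leaves a combination
of `Hl` and `Hs` with constant weights. -/
lemma map_eq (hX : IsClaimSizes X N β Hl Hs μ) (hN : IsClaimCountingProcess N)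
    (hβ : 0 ≤ β) (hA : MeasurableSet[arrivalSigma N] A) (hAn : ∀ ω ∈ A, ∃ t, n ≤ N t ω)
    (hi : i ∈ Finset.Icc 1 n) :
    (μ.restrict A).map (X i) =
      (∫ ω in A, (1 - Real.exp (-(β * interClaimTime N i ω))) ∂μ).toNNReal • Hl +
      (∫ ω in A, Real.exp (-(β * interClaimTime N i ω)) ∂μ).toNNReal • Hs := by
  have hA' : MeasurableSet A := hN.arrivalSigma_le _ hA
  have hmem := exp_mem hN hβ hAn (Finset.mem_Icc.1 hi).2
  have hm := hN.measurable_interClaimTime i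
  have he : IntegrableOn (fun ω => Real.exp (-(β * interClaimTime N i ω))) A μ := by
    refine Integrable.of_bound (C := 1) (by fun_prop) (ae_restrict_of_forall_mem hA' fun ω hω => ?_)
    rw [Real.norm_of_nonneg (hmem ω hω).1]; exact (hmem ω hω).2
  refine Measure.ext_of_Iic _ _ fun y => ?_
  rw [← ENNReal.toReal_eq_toReal_iff' (measure_ne_top _ _) (measure_ne_top _ _),
    ← measureReal_def, ← measureReal_def, measureReal_add_apply, measureReal_nnreal_smul_apply,
    measureReal_nnreal_smul_apply, map_measureReal_apply (hX.measurable i) measurableSet_Iic,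
    measureReal_restrict_apply (hX.measurable i measurableSet_Iic), Set.inter_comm,
    Real.coe_toNNReal _ (setIntegral_nonneg hA' fun ω hω => by linarith [(hmem ω hω).2]),
    Real.coe_toNNReal _ (setIntegral_nonneg hA' fun ω hω => (hmem ω hω).1),
    ← cdf_eq_real, ← cdf_eq_real]
  have := hX.measureReal_inter hN hβ hA hAn (Finset.singleton_subset_iff.2 hi) fun _ => y
  simp only [Finset.mem_singleton, forall_eq, Finset.prod_singleton] at this
  change μ.real (A ∩ {ω | X i ω ≤ y}) = _
  rw [this, ← integral_mul_const, ← integral_mul_const, ← integral_add]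
  · rfl
  · exact ((integrable_const 1).sub he).mul_const _
  · exact he.mul_const _

lemma setIntegral_comp (hX : IsClaimSizes X N β Hl Hs μ) (hN : IsClaimCountingProcess N)
    (hβ : 0 ≤ β) (hA : MeasurableSet[arrivalSigma N] A) (hAn : ∀ ω ∈ A, ∃ t, n ≤ N t ω)
    (hi : i ∈ Finset.Icc 1 n) {g : ℝ → ℝ} (hgm : Measurable g) (hgl : Integrable g Hl)
    (hgs : Integrable g Hs) :
    IntegrableOn (fun ω => g (X i ω)) A μ ∧
    ∫ ω in A, g (X i ω) ∂μ = ∫ ω in A, ((∫ y, g y ∂Hl) +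
      ((∫ y, g y ∂Hs) - ∫ y, g y ∂Hl) * Real.exp (-(β * interClaimTime N i ω))) ∂μ := by
  have hA' : MeasurableSet A := hN.arrivalSigma_le _ hA
  have hmem := exp_mem hN hβ hAn (Finset.mem_Icc.1 hi).2
  have hm := hN.measurable_interClaimTime i
  have he : IntegrableOn (fun ω => Real.exp (-(β * interClaimTime N i ω))) A μ := by
    refine Integrable.of_bound (C := 1) (by fun_prop) (ae_restrict_of_forall_mem hA' fun ω hω => ?_)
    rw [Real.norm_of_nonneg (hmem ω hω).1]; exact (hmem ω hω).2
  have hmap := hX.map_eq hN hβ hA hAn hi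
  have hil := hgl.smul_measure_nnreal
    (c := (∫ ω in A, (1 - Real.exp (-(β * interClaimTime N i ω))) ∂μ).toNNReal)
  have his := hgs.smul_measure_nnreal
    (c := (∫ ω in A, Real.exp (-(β * interClaimTime N i ω)) ∂μ).toNNReal)
  constructor
  · have : Integrable g ((μ.restrict A).map (X i)) := by
      rw [hmap]; exact hil.add_measure his
    exact this.comp_measurable (hX.measurable i)
  · rw [← integral_map (φ := X i) (f := g) (hX.measurable i).aemeasurable
      hgm.aestronglyMeasurable, hmap, integral_add_measure hil his,
      integral_smul_nnreal_measure, integral_smul_nnreal_measure, NNReal.smul_def, NNReal.smul_def,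
      Real.coe_toNNReal _ (setIntegral_nonneg hA' fun ω hω => by linarith [(hmem ω hω).2]),
      Real.coe_toNNReal _ (setIntegral_nonneg hA' fun ω hω => (hmem ω hω).1), smul_eq_mul,
      smul_eq_mul, ← integral_mul_const, ← integral_mul_const, ← integral_add]
    · congr 1; ext ω; ring
    · exact ((integrable_const 1).sub he).mul_const _
    · exact he.mul_const _

/-- Conditional independence makes the joint cdf a product of two affine expressions; multiplying
out gives the four product laws. -/
lemma map_prod_eq (hX : IsClaimSizes X N β Hl Hs μ) (hN : IsClaimCountingProcess N)
    (hβ : 0 ≤ β) (hA : MeasurableSet[arrivalSigma N] A) (hAn : ∀ ω ∈ A, ∃ t, n ≤ N t ω)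
    (hi : i ∈ Finset.Icc 1 n) (hj : j ∈ Finset.Icc 1 n) (hij : i ≠ j) :
    (μ.restrict A).map (fun ω => (X i ω, X j ω)) =
      (∫ ω in A, (1 - Real.exp (-(β * interClaimTime N i ω))) *
        (1 - Real.exp (-(β * interClaimTime N j ω))) ∂μ).toNNReal • Hl.prod Hl +
      (∫ ω in A, (1 - Real.exp (-(β * interClaimTime N i ω))) *
        Real.exp (-(β * interClaimTime N j ω)) ∂μ).toNNReal • Hl.prod Hs +
      (∫ ω in A, Real.exp (-(β * interClaimTime N i ω)) *
        (1 - Real.exp (-(β * interClaimTime N j ω))) ∂μ).toNNReal • Hs.prod Hl +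
      (∫ ω in A, Real.exp (-(β * interClaimTime N i ω)) *
        Real.exp (-(β * interClaimTime N j ω)) ∂μ).toNNReal • Hs.prod Hs := by
  have hA' : MeasurableSet A := hN.arrivalSigma_le _ hA
  have hmi := exp_mem hN hβ hAn (Finset.mem_Icc.1 hi).2
  have hmj := exp_mem hN hβ hAn (Finset.mem_Icc.1 hj).2
  have hvi := hN.measurable_interClaimTime i
  have hvj := hN.measurable_interClaimTime j
  set e := fun ω => Real.exp (-(β * interClaimTime N i ω)) with he
  set f := fun ω => Real.exp (-(β * interClaimTime N j ω)) with hf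
  have hem : Measurable e := by fun_prop
  have hfm : Measurable f := by fun_prop
  have hXm : Measurable fun ω => (X i ω, X j ω) := (hX.measurable i).prodMk (hX.measurable j)
  have hint : ∀ g h : Ω → ℝ, Measurable g → Measurable h → (∀ ω ∈ A, 0 ≤ g ω ∧ g ω ≤ 1) →
      (∀ ω ∈ A, 0 ≤ h ω ∧ h ω ≤ 1) → IntegrableOn (fun ω => g ω * h ω) A μ := by
    intro g h hg hh hg1 hh1
    refine Integrable.of_bound (C := 1) (by fun_prop) (ae_restrict_of_forall_mem hA' fun ω hω => ?_)
    rw [Real.norm_of_nonneg (mul_nonneg (hg1 ω hω).1 (hh1 ω hω).1)]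
    exact mul_le_one₀ (hg1 ω hω).2 (hh1 ω hω).1 (hh1 ω hω).2
  have hmi' : ∀ ω ∈ A, 0 ≤ 1 - e ω ∧ 1 - e ω ≤ 1 := fun ω hω =>
    ⟨by linarith [(hmi ω hω).2], by linarith [(hmi ω hω).1]⟩
  have hmj' : ∀ ω ∈ A, 0 ≤ 1 - f ω ∧ 1 - f ω ≤ 1 := fun ω hω =>
    ⟨by linarith [(hmj ω hω).2], by linarith [(hmj ω hω).1]⟩
  have hll := hint (fun ω => 1 - e ω) (fun ω => 1 - f ω) (by fun_prop) (by fun_prop) hmi' hmj'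
  have hls := hint (fun ω => 1 - e ω) f (by fun_prop) (by fun_prop) hmi' hmj
  have hsl := hint e (fun ω => 1 - f ω) (by fun_prop) (by fun_prop) hmi hmj'
  have hss := hint e f (by fun_prop) (by fun_prop) hmi hmj
  have hnn : ∀ g h : Ω → ℝ, (∀ ω ∈ A, 0 ≤ g ω ∧ g ω ≤ 1) → (∀ ω ∈ A, 0 ≤ h ω ∧ h ω ≤ 1) →
      0 ≤ ∫ ω in A, g ω * h ω ∂μ := fun g h hg hh =>
    setIntegral_nonneg hA' fun ω hω => mul_nonneg (hg ω hω).1 (hh ω hω).1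
  refine Measure.ext_of_Iic_prod_Iic fun x y => ?_
  have hxy : MeasurableSet (Set.Iic x ×ˢ Set.Iic y) := measurableSet_Iic.prod measurableSet_Iic
  rw [← ENNReal.toReal_eq_toReal_iff' (measure_ne_top _ _) (measure_ne_top _ _),
    ← measureReal_def, ← measureReal_def, measureReal_add_apply, measureReal_add_apply,
    measureReal_add_apply]
  simp only [measureReal_nnreal_smul_apply]
  rw [map_measureReal_apply hXm hxy, measureReal_restrict_apply (hXm hxy), Set.inter_comm,
    Real.coe_toNNReal _ (hnn _ _ hmi' hmj'), Real.coe_toNNReal _ (hnn _ _ hmi' hmj),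
    Real.coe_toNNReal _ (hnn _ _ hmi hmj'), Real.coe_toNNReal _ (hnn _ _ hmi hmj)]
  simp only [measureReal_prod_prod, ← cdf_eq_real]
  have := hX.measureReal_inter hN hβ hA hAn
    (Finset.insert_subset hi (Finset.singleton_subset_iff.2 hj)) fun k => if k = i then x else y
  simp only [Finset.mem_insert, Finset.mem_singleton, forall_eq_or_imp, forall_eq,
    Finset.prod_pair hij, if_true, hij.symm, if_false] at this
  change μ.real (A ∩ {ω | X i ω ≤ x ∧ X j ω ≤ y}) = _
  rw [this]
  refine Eq.trans ?_ (sum_integral_mul_const hll hls hsl hss _ _ _ _).symm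
  congr 1; ext ω
  simp only [claimCdf, he, hf]
  ring

/-- Under each of the four product laws the mean of the product factorizes, and the four terms
recombine into the product of the conditional means. -/
lemma setIntegral_mul (hX : IsClaimSizes X N β Hl Hs μ) (hN : IsClaimCountingProcess N)
    (hβ : 0 ≤ β) (hA : MeasurableSet[arrivalSigma N] A) (hAn : ∀ ω ∈ A, ∃ t, n ≤ N t ω)
    (hi : i ∈ Finset.Icc 1 n) (hj : j ∈ Finset.Icc 1 n) (hij : i ≠ j)
    (hHl : Integrable (fun y : ℝ => y) Hl) (hHs : Integrable (fun y : ℝ => y) Hs) :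
    IntegrableOn (fun ω => X i ω * X j ω) A μ ∧
    ∫ ω in A, X i ω * X j ω ∂μ = ∫ ω in A, ((∫ y, y ∂Hl) +
        ((∫ y, y ∂Hs) - ∫ y, y ∂Hl) * Real.exp (-(β * interClaimTime N i ω))) *
      ((∫ y, y ∂Hl) +
        ((∫ y, y ∂Hs) - ∫ y, y ∂Hl) * Real.exp (-(β * interClaimTime N j ω))) ∂μ := by
  have hA' : MeasurableSet A := hN.arrivalSigma_le _ hA
  have hmi := exp_mem hN hβ hAn (Finset.mem_Icc.1 hi).2
  have hmj := exp_mem hN hβ hAn (Finset.mem_Icc.1 hj).2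
  have hvi := hN.measurable_interClaimTime i
  have hvj := hN.measurable_interClaimTime j
  have hmap := hX.map_prod_eq hN hβ hA hAn hi hj hij
  set e := fun ω => Real.exp (-(β * interClaimTime N i ω)) with he
  set f := fun ω => Real.exp (-(β * interClaimTime N j ω)) with hf
  have hem : Measurable e := by fun_prop
  have hfm : Measurable f := by fun_prop
  have hXm : Measurable fun ω => (X i ω, X j ω) := (hX.measurable i).prodMk (hX.measurable j)
  have hint : ∀ g h : Ω → ℝ, Measurable g → Measurable h → (∀ ω ∈ A, 0 ≤ g ω ∧ g ω ≤ 1) →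
      (∀ ω ∈ A, 0 ≤ h ω ∧ h ω ≤ 1) → IntegrableOn (fun ω => g ω * h ω) A μ := by
    intro g h hg hh hg1 hh1
    refine Integrable.of_bound (C := 1) (by fun_prop) (ae_restrict_of_forall_mem hA' fun ω hω => ?_)
    rw [Real.norm_of_nonneg (mul_nonneg (hg1 ω hω).1 (hh1 ω hω).1)]
    exact mul_le_one₀ (hg1 ω hω).2 (hh1 ω hω).1 (hh1 ω hω).2
  have hmi' : ∀ ω ∈ A, 0 ≤ 1 - e ω ∧ 1 - e ω ≤ 1 := fun ω hω =>
    ⟨by linarith [(hmi ω hω).2], by linarith [(hmi ω hω).1]⟩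
  have hmj' : ∀ ω ∈ A, 0 ≤ 1 - f ω ∧ 1 - f ω ≤ 1 := fun ω hω =>
    ⟨by linarith [(hmj ω hω).2], by linarith [(hmj ω hω).1]⟩
  have hll := hint (fun ω => 1 - e ω) (fun ω => 1 - f ω) (by fun_prop) (by fun_prop) hmi' hmj'
  have hls := hint (fun ω => 1 - e ω) f (by fun_prop) (by fun_prop) hmi' hmj
  have hsl := hint e (fun ω => 1 - f ω) (by fun_prop) (by fun_prop) hmi hmj'
  have hss := hint e f (by fun_prop) (by fun_prop) hmi hmj
  have hnn : ∀ g h : Ω → ℝ, (∀ ω ∈ A, 0 ≤ g ω ∧ g ω ≤ 1) → (∀ ω ∈ A, 0 ≤ h ω ∧ h ω ≤ 1) →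
      0 ≤ ∫ ω in A, g ω * h ω ∂μ := fun g h hg hh =>
    setIntegral_nonneg hA' fun ω hω => mul_nonneg (hg ω hω).1 (hh ω hω).1
  have ill := (hHl.mul_prod hHl).smul_measure_nnreal
    (c := (∫ ω in A, (1 - e ω) * (1 - f ω) ∂μ).toNNReal)
  have ils := (hHl.mul_prod hHs).smul_measure_nnreal
    (c := (∫ ω in A, (1 - e ω) * f ω ∂μ).toNNReal)
  have isl := (hHs.mul_prod hHl).smul_measure_nnreal
    (c := (∫ ω in A, e ω * (1 - f ω) ∂μ).toNNReal)
  have iss := (hHs.mul_prod hHs).smul_measure_nnreal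
    (c := (∫ ω in A, e ω * f ω ∂μ).toNNReal)
  constructor
  · have : Integrable (fun z : ℝ × ℝ => z.1 * z.2)
        ((μ.restrict A).map fun ω => (X i ω, X j ω)) := by
      rw [hmap]; exact ((ill.add_measure ils).add_measure isl).add_measure iss
    exact this.comp_measurable hXm
  · rw [← integral_map (φ := fun ω => (X i ω, X j ω)) (f := fun z : ℝ × ℝ => z.1 * z.2)
      hXm.aemeasurable (measurable_fst.mul measurable_snd).aestronglyMeasurable, hmap,
      integral_add_measure ((ill.add_measure ils).add_measure isl) iss,
      integral_add_measure (ill.add_measure ils) isl, integral_add_measure ill ils]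
    simp only [integral_smul_nnreal_measure, NNReal.smul_def]
    rw [Real.coe_toNNReal _ (hnn _ _ hmi' hmj'), Real.coe_toNNReal _ (hnn _ _ hmi' hmj),
      Real.coe_toNNReal _ (hnn _ _ hmi hmj'), Real.coe_toNNReal _ (hnn _ _ hmi hmj)]
    simp only [integral_prod_mul (fun y : ℝ => y) (fun y : ℝ => y), smul_eq_mul]
    refine (sum_integral_mul_const hll hls hsl hss _ _ _ _).trans ?_
    congr 1; ext ω
    ring

end IsClaimSizes

/-! ### Reduction of the aggregate claim to the weights -/

lemma sq_sum_range_eq (x : ℕ → ℝ) (n : ℕ) :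
    (∑ i ∈ Finset.range n, x i) ^ 2 = ∑ i ∈ Finset.range n, x i ^ 2 +
      2 * ∑ j ∈ Finset.range n, x j * ∑ i ∈ Finset.range j, x i := by
  induction n with
  | zero => simp
  | succ n ih =>
    simp only [Finset.sum_range_succ]
    linear_combination ih

lemma aggregateClaim_eq_sum_range {Ω : Type*} (X : ℕ → Ω → ℝ) (N : ℝ≥0 → Ω → ℕ) (t : ℝ≥0)
    (ω : Ω) : aggregateClaim X N t ω = ∑ i ∈ Finset.range (N t ω), X (i + 1) ω := by
  rw [aggregateClaim, ← Finset.Ico_add_one_right_eq_Icc, Finset.sum_Ico_eq_sum_range]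
  simp [add_comm]

lemma measurable_aggregateClaim {Ω : Type*} [MeasurableSpace Ω] {X : ℕ → Ω → ℝ}
    {N : ℝ≥0 → Ω → ℕ} (hX : ∀ i, Measurable (X i)) (hN : IsClaimCountingProcess N) (t : ℝ≥0) :
    Measurable (aggregateClaim X N t) :=
  measurable_comp_natIndex (F := fun n ω => ∑ i ∈ Finset.Icc 1 n, X i ω)
    (fun _ => Finset.measurable_fun_sum _ fun i _ => hX i) (hN.measurable t)

section Level

variable {Ω : Type*} [MeasurableSpace Ω] {μ : Measure Ω} {M : Ω → ℕ} {f g : Ω → ℝ}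

lemma hasSum_setIntegral_level (hM : Measurable M) (hf : Integrable f μ) :
    HasSum (fun n => ∫ ω in M ⁻¹' {n}, f ω ∂μ) (∫ ω, f ω ∂μ) := by
  have := hasSum_integral_iUnion (μ := μ) (f := f) (s := fun n => M ⁻¹' {n})
    (fun n => hM (measurableSet_singleton n))
    (fun i j hij => Disjoint.preimage M (Set.disjoint_singleton.2 hij)) hf.integrableOn
  rwa [← Set.preimage_iUnion, Set.iUnion_of_singleton, Set.preimage_univ, setIntegral_univ] at this

lemma integral_eq_of_setIntegral_level_eq (hM : Measurable M) (hf : Integrable f μ)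
    (hg : Integrable g μ) (h : ∀ n, ∫ ω in M ⁻¹' {n}, f ω ∂μ = ∫ ω in M ⁻¹' {n}, g ω ∂μ) :
    ∫ ω, f ω ∂μ = ∫ ω, g ω ∂μ := by
  have := hasSum_setIntegral_level hM hf
  simp only [h] at this
  exact this.unique (hasSum_setIntegral_level hM hg)

/-- No prior bound on `f` is needed: being nonnegative, it is integrable once its integrals over the
levels are summable, and they are those of `g`. -/
lemma integrable_of_setIntegral_level_eq (hM : Measurable M) (hf0 : ∀ ω, 0 ≤ f ω)
    (hf : ∀ n, IntegrableOn f (M ⁻¹' {n}) μ) (hg : Integrable g μ)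
    (h : ∀ n, ∫ ω in M ⁻¹' {n}, f ω ∂μ = ∫ ω in M ⁻¹' {n}, g ω ∂μ) : Integrable f μ := by
  have := integrableOn_iUnion_of_summable_integral_norm hf (by
    simp only [Real.norm_of_nonneg (hf0 _), h]
    exact (hasSum_setIntegral_level hM hg).summable)
  rwa [← Set.preimage_iUnion, Set.iUnion_of_singleton, Set.preimage_univ,
    integrableOn_univ] at this

end Level

section Aggregate

variable {Ω : Type*} [MeasurableSpace Ω] {μ : Measure Ω} [IsProbabilityMeasure μ]
  {Hl Hs : Measure ℝ} [IsProbabilityMeasure Hl] [IsProbabilityMeasure Hs] {β : ℝ}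
  {N : ℝ≥0 → Ω → ℕ} {X : ℕ → Ω → ℝ}

namespace IsClaimSizes

/-- On `{N t = n}`, an arrival event on which `n` claims are present, `S²` is a finite sum of
squares and products. There each term may be replaced by its conditional mean, a weight or a product
of two weights; the levels are then added up. -/
lemma aggregateClaim_sq (hX : IsClaimSizes X N β Hl Hs μ) (hN : IsClaimCountingProcess N)
    (hβ : 0 ≤ β) (hHl : MemLp (fun y : ℝ => y) 2 Hl) (hHs : MemLp (fun y : ℝ => y) 2 Hs)
    {t : ℝ≥0} (hNt : MemLp (fun ω => (N t ω : ℝ)) 2 μ) :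
    MemLp (aggregateClaim X N t) 2 μ ∧
    ∫ ω, aggregateClaim X N t ω ^ 2 ∂μ =
      (∫ ω, ∑ i ∈ Finset.range (N t ω),
        claimWeight N (∫ y, y ^ 2 ∂Hl) ((∫ y, y ^ 2 ∂Hs) - ∫ y, y ^ 2 ∂Hl) β i ω ∂μ) +
      2 * ∫ ω, ∑ j ∈ Finset.range (N t ω),
        claimWeight N (∫ y, y ∂Hl) ((∫ y, y ∂Hs) - ∫ y, y ∂Hl) β j ω *
        ∑ i ∈ Finset.range j,
          claimWeight N (∫ y, y ∂Hl) ((∫ y, y ∂Hs) - ∫ y, y ∂Hl) β i ω ∂μ := by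
  set q := claimWeight N (∫ y, y ^ 2 ∂Hl) ((∫ y, y ^ 2 ∂Hs) - ∫ y, y ^ 2 ∂Hl) β with hq
  set m := claimWeight N (∫ y, y ∂Hl) ((∫ y, y ∂Hs) - ∫ y, y ∂Hl) β with hm
  have hMt := hN.measurable t
  have iq := hN.integrable_sum_claimWeight (∫ y, y ^ 2 ∂Hl)
    ((∫ y, y ^ 2 ∂Hs) - ∫ y, y ^ 2 ∂Hl) hβ (hNt.integrable (by norm_num))
  have im := hN.integrable_sum_mul_claimWeight (∫ y, y ∂Hl)
    ((∫ y, y ∂Hs) - ∫ y, y ∂Hl) hβ hNt.integrable_sq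
  have hAσ : ∀ n, MeasurableSet[arrivalSigma N] (N t ⁻¹' {n}) := fun n =>
    le_iSup (fun t => MeasurableSpace.comap (N t) ⊤) t _ ⟨{n}, trivial, rfl⟩
  have hA : ∀ n, MeasurableSet (N t ⁻¹' {n}) := fun n => hMt (measurableSet_singleton n)
  have hAn : ∀ n, ∀ ω ∈ N t ⁻¹' {n}, ∃ t, n ≤ N t ω := fun n ω hω => ⟨t, hω.ge⟩
  have hI : ∀ {i n}, i < n → i + 1 ∈ Finset.Icc 1 n := fun hi =>
    Finset.mem_Icc.2 ⟨Nat.succ_pos _, hi⟩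
  have hHl1 : Integrable (fun y : ℝ => y) Hl := hHl.integrable (by norm_num)
  have hHs1 : Integrable (fun y : ℝ => y) Hs := hHs.integrable (by norm_num)
  have single : ∀ {i n}, i < n → IntegrableOn (fun ω => X (i + 1) ω ^ 2) (N t ⁻¹' {n}) μ ∧
      ∫ ω in N t ⁻¹' {n}, X (i + 1) ω ^ 2 ∂μ = ∫ ω in N t ⁻¹' {n}, q i ω ∂μ := fun {i n} hi =>
    hX.setIntegral_comp hN hβ (hAσ n) (hAn n) (hI hi) (by fun_prop) hHl.integrable_sq
      hHs.integrable_sq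
  have pair : ∀ {i j n}, i < j → j < n →
      IntegrableOn (fun ω => X (j + 1) ω * X (i + 1) ω) (N t ⁻¹' {n}) μ ∧
      ∫ ω in N t ⁻¹' {n}, X (j + 1) ω * X (i + 1) ω ∂μ =
        ∫ ω in N t ⁻¹' {n}, m j ω * m i ω ∂μ := fun {i j n} hi hj =>
    hX.setIntegral_mul hN hβ (hAσ n) (hAn n) (hI hj) (hI (hi.trans hj)) (by omega) hHl1 hHs1
  have bdd : ∀ (a b : ℝ) {i n}, i < n → ∀ᵐ ω ∂μ.restrict (N t ⁻¹' {n}),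
      ‖claimWeight N a b β i ω‖ ≤ |a| + |b| := fun a b {i n} hi =>
    ae_restrict_of_forall_mem (hA n) fun ω hω =>
      hN.abs_claimWeight_le a b hβ (t := t) (hi.trans_eq (Eq.symm hω))
  have qint : ∀ {i n}, i < n → IntegrableOn (q i) (N t ⁻¹' {n}) μ := fun hi =>
    Integrable.of_bound (hN.measurable_claimWeight _ _ β _).aestronglyMeasurable _ (bdd _ _ hi)
  have mint : ∀ {i j n}, i < j → j < n →
      IntegrableOn (fun ω => m j ω * m i ω) (N t ⁻¹' {n}) μ := fun {i j n} hi hj =>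
    Integrable.bdd_mul (Integrable.of_bound
      (hN.measurable_claimWeight _ _ β _).aestronglyMeasurable _ (bdd _ _ (hi.trans hj)))
      (hN.measurable_claimWeight _ _ β _).aestronglyMeasurable (bdd _ _ hj)
  -- Stated for general families, since it serves both the claims and their weights.
  have expand : ∀ n (F : ℕ → ℕ → Ω → ℝ) (G : ℕ → Ω → ℝ),
      (∀ i < n, IntegrableOn (G i) (N t ⁻¹' {n}) μ) →
      (∀ j < n, ∀ i < j, IntegrableOn (F j i) (N t ⁻¹' {n}) μ) →
      IntegrableOn (fun ω => ∑ i ∈ Finset.range n, G i ω +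
        2 * ∑ j ∈ Finset.range n, ∑ i ∈ Finset.range j, F j i ω) (N t ⁻¹' {n}) μ ∧
      ∫ ω in N t ⁻¹' {n}, (∑ i ∈ Finset.range n, G i ω +
        2 * ∑ j ∈ Finset.range n, ∑ i ∈ Finset.range j, F j i ω) ∂μ =
      ∑ i ∈ Finset.range n, ∫ ω in N t ⁻¹' {n}, G i ω ∂μ +
        2 * ∑ j ∈ Finset.range n, ∑ i ∈ Finset.range j, ∫ ω in N t ⁻¹' {n}, F j i ω ∂μ := by
    intro n F G hG hF
    have h1 : IntegrableOn (fun ω => ∑ i ∈ Finset.range n, G i ω) (N t ⁻¹' {n}) μ :=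
      integrable_finsetSum _ fun i hi => hG i (Finset.mem_range.1 hi)
    have h2 : ∀ j ∈ Finset.range n,
        IntegrableOn (fun ω => ∑ i ∈ Finset.range j, F j i ω) (N t ⁻¹' {n}) μ := fun j hj =>
      integrable_finsetSum _ fun i hi => hF j (Finset.mem_range.1 hj) i (Finset.mem_range.1 hi)
    have h3 := (integrable_finsetSum _ h2).const_mul 2
    refine ⟨h1.add h3, ?_⟩
    rw [integral_add h1 h3, integral_const_mul, integral_finsetSum _ h2,
      integral_finsetSum _ fun i hi => hG i (Finset.mem_range.1 hi)]
    congr 2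
    exact Finset.sum_congr rfl fun j hj => integral_finsetSum _ fun i hi =>
      hF j (Finset.mem_range.1 hj) i (Finset.mem_range.1 hi)
  have hS : ∀ n, ∀ ω ∈ N t ⁻¹' {n}, aggregateClaim X N t ω ^ 2 =
      ∑ i ∈ Finset.range n, X (i + 1) ω ^ 2 +
        2 * ∑ j ∈ Finset.range n, ∑ i ∈ Finset.range j, X (j + 1) ω * X (i + 1) ω := by
    intro n ω hω
    rw [aggregateClaim_eq_sum_range, show N t ω = n from hω, sq_sum_range_eq]
    simp only [Finset.mul_sum]
  have hG : ∀ n, ∀ ω ∈ N t ⁻¹' {n}, ∑ i ∈ Finset.range (N t ω), q i ω +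
      2 * ∑ j ∈ Finset.range (N t ω), m j ω * ∑ i ∈ Finset.range j, m i ω =
      ∑ i ∈ Finset.range n, q i ω +
        2 * ∑ j ∈ Finset.range n, ∑ i ∈ Finset.range j, m j ω * m i ω := by
    intro n ω hω
    rw [show N t ω = n from hω]
    simp only [Finset.mul_sum]
  have eS := fun n => expand n (fun j i ω => X (j + 1) ω * X (i + 1) ω)
    (fun i ω => X (i + 1) ω ^ 2) (fun i hi => (single hi).1) (fun j hj i hi => (pair hi hj).1)
  have eG := fun n => expand n (fun j i ω => m j ω * m i ω) q (fun i hi => qint hi)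
    (fun j hj i hi => mint hi hj)
  have hSint : ∀ n, IntegrableOn (fun ω => aggregateClaim X N t ω ^ 2) (N t ⁻¹' {n}) μ := fun n =>
    (eS n).1.congr_fun (fun ω hω => (hS n ω hω).symm) (hA n)
  have hGi := iq.add (im.const_mul 2)
  have heq : ∀ n, ∫ ω in N t ⁻¹' {n}, aggregateClaim X N t ω ^ 2 ∂μ =
      ∫ ω in N t ⁻¹' {n}, (∑ i ∈ Finset.range (N t ω), q i ω +
        2 * ∑ j ∈ Finset.range (N t ω), m j ω * ∑ i ∈ Finset.range j, m i ω) ∂μ := by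
    intro n
    rw [setIntegral_congr_fun (hA n) (hS n), setIntegral_congr_fun (hA n) (hG n), (eS n).2,
      (eG n).2]
    congr 1
    · exact Finset.sum_congr rfl fun i hi => (single (Finset.mem_range.1 hi)).2
    · congr 1
      exact Finset.sum_congr rfl fun j hj => Finset.sum_congr rfl fun i hi =>
        (pair (Finset.mem_range.1 hi) (Finset.mem_range.1 hj)).2
  have hint : Integrable (fun ω => aggregateClaim X N t ω ^ 2) μ :=
    integrable_of_setIntegral_level_eq hMt (fun _ => sq_nonneg _) hSint hGi heq
  refine ⟨(memLp_two_iff_integrable_sq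
    (measurable_aggregateClaim hX.measurable hN t).aestronglyMeasurable).2 hint, ?_⟩
  rw [integral_eq_of_setIntegral_level_eq hMt hint hGi heq, ← integral_const_mul,
    ← integral_add iq (im.const_mul 2)]
  rfl

lemma integral_aggregateClaim (hX : IsClaimSizes X N β Hl Hs μ) (hN : IsClaimCountingProcess N)
    (hβ : 0 ≤ β) (hHl : Integrable (fun y : ℝ => y) Hl) (hHs : Integrable (fun y : ℝ => y) Hs)
    {t : ℝ≥0} (hNt : Integrable (fun ω => (N t ω : ℝ)) μ)
    (hS : Integrable (aggregateClaim X N t) μ) :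
    ∫ ω, aggregateClaim X N t ω ∂μ =
      ∫ ω, ∑ i ∈ Finset.range (N t ω),
        claimWeight N (∫ y, y ∂Hl) ((∫ y, y ∂Hs) - ∫ y, y ∂Hl) β i ω ∂μ := by
  have hMt := hN.measurable t
  have hA : ∀ n, MeasurableSet (N t ⁻¹' {n}) := fun n => hMt (measurableSet_singleton n)
  refine integral_eq_of_setIntegral_level_eq hMt hS (hN.integrable_sum_claimWeight _ _ hβ hNt)
    fun n => ?_
  have hAσ : MeasurableSet[arrivalSigma N] (N t ⁻¹' {n}) :=
    le_iSup (fun t => MeasurableSpace.comap (N t) ⊤) t _ ⟨{n}, trivial, rfl⟩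
  have single := fun i (hi : i ∈ Finset.range n) =>
    hX.setIntegral_comp hN hβ hAσ (fun ω hω => ⟨t, hω.ge⟩)
      (Finset.mem_Icc.2 ⟨Nat.succ_pos _, Finset.mem_range.1 hi⟩) measurable_id hHl hHs
  have bdd := fun i (hi : i ∈ Finset.range n) =>
    Integrable.of_bound (μ := μ.restrict (N t ⁻¹' {n}))
      (hN.measurable_claimWeight (∫ y, y ∂Hl) ((∫ y, y ∂Hs) - ∫ y, y ∂Hl) β i).aestronglyMeasurable
      _ (ae_restrict_of_forall_mem (hA n) fun ω hω => hN.abs_claimWeight_le _ _ hβ (t := t)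
        ((Finset.mem_range.1 hi).trans_eq (Eq.symm hω)))
  calc ∫ ω in N t ⁻¹' {n}, aggregateClaim X N t ω ∂μ
      = ∫ ω in N t ⁻¹' {n}, ∑ i ∈ Finset.range n, X (i + 1) ω ∂μ :=
        setIntegral_congr_fun (hA n) fun ω hω => by
          rw [aggregateClaim_eq_sum_range, show N t ω = n from hω]
    _ = ∑ i ∈ Finset.range n, ∫ ω in N t ⁻¹' {n}, X (i + 1) ω ∂μ :=
        integral_finsetSum _ fun i hi => (single i hi).1
    _ = ∑ i ∈ Finset.range n, ∫ ω in N t ⁻¹' {n},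
          claimWeight N (∫ y, y ∂Hl) ((∫ y, y ∂Hs) - ∫ y, y ∂Hl) β i ω ∂μ :=
        Finset.sum_congr rfl fun i hi => (single i hi).2
    _ = ∫ ω in N t ⁻¹' {n}, ∑ i ∈ Finset.range n,
          claimWeight N (∫ y, y ∂Hl) ((∫ y, y ∂Hs) - ∫ y, y ∂Hl) β i ω ∂μ :=
        (integral_finsetSum _ bdd).symm
    _ = _ := setIntegral_congr_fun (hA n) fun ω hω => by
          rw [show N t ω = n from hω]

end IsClaimSizes

end Aggregate

/-! ### Expansion in `t` with a uniformly bounded remainder -/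

section Asymptotics

variable {β : ℝ}

lemma ratio_mem {x y : ℝ} (hx : 0 ≤ x) (hy : 0 ≤ y) : 0 ≤ x / (x + y) ∧ x / (x + y) ≤ 1 :=
  ⟨by positivity, div_le_one_of_le₀ (by linarith) (by positivity)⟩

/-- The coefficient of `t` in the second moment of the aggregate claim, for arrivals with rate `l`,
where `ql`, `qs` are the second moments and `ml`, `ms` the means of the claim sizes. -/
noncomputable def linearCoeff (ql qs ml ms β l : ℝ) : ℝ :=
  (ql * (β / (β + l)) + qs * (l / (β + l))
    + 4 * (ms - ml) * (β / (β + l)) * (l / (β + l))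
      * (ml * (β / (β + l)) + ms * (l / (β + l)))) * l

/-- The coefficient of `t ^ 2` in the second moment of the aggregate claim. -/
noncomputable def quadraticCoeff (ml ms β l : ℝ) : ℝ :=
  (ml * (β / (β + l)) + ms * (l / (β + l))) ^ 2 * l ^ 2

/-- The powers `t` and `t²` cancel exactly. The rest consists of products of the two ratios with `1
- exp (-x)` or `1 - exp (-x) - x exp (-x)`, where `x = (β + l) t`. The bound is free of `l`, so it
survives integration against `L`. -/
lemma abs_moments_sub_le (hβ : 0 ≤ β) (ql qs ml ms : ℝ) {t l : ℝ} (ht : 0 ≤ t) (hl : 0 ≤ l) :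
    |firstMoment ql (qs - ql) β t l + 2 * secondMoment ml (ms - ml) β t l
      - (linearCoeff ql qs ml ms β l * t + quadraticCoeff ml ms β l * t ^ 2)| ≤
    |qs - ql| + 4 * |ms - ml| * (|ml| + |ms|) + 4 * |ms - ml| ^ 2 := by
  -- If `β + l = 0` then `l = 0` and everything vanishes.
  rcases eq_or_lt_of_le (add_nonneg hβ hl) with hc | hc
  · have hl0 : l = 0 := by linarith
    simp only [firstMoment, secondMoment, linearCoeff, quadraticCoeff, hl0]
    norm_num
    positivity
  obtain ⟨hη0, hη1⟩ := ratio_mem hβ hl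
  obtain ⟨hκ0, hκ1⟩ := ratio_mem hl hβ
  rw [add_comm l β] at hκ0 hκ1
  have hsum : β / (β + l) = 1 - l / (β + l) := by field_simp; ring
  have hE0 := Real.exp_pos (-((β + l) * t))
  have hE1 : Real.exp (-((β + l) * t)) ≤ 1 := by
    rw [Real.exp_le_one_iff, neg_nonpos]; positivity
  have hct : 0 ≤ (β + l) * t := by positivity
  have hE2 : (β + l) * t * Real.exp (-((β + l) * t)) ≤ 1 := by
    have h1 := Real.add_one_le_exp ((β + l) * t)
    rw [Real.exp_neg, ← div_eq_mul_inv, div_le_one (Real.exp_pos _)]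
    linarith
  unfold firstMoment secondMoment linearCoeff quadraticCoeff
  set E := Real.exp (-((β + l) * t))
  set η := β / (β + l)
  set κ := l / (β + l)
  set F := (β + l) * t * E with hF
  have hF0 : 0 ≤ F := by positivity
  have hD : |ml * η + ms * κ| ≤ |ml| + |ms| := by
    refine (abs_add_le _ _).trans ?_
    rw [abs_mul, abs_mul, abs_of_nonneg hη0, abs_of_nonneg hκ0]
    exact add_le_add (mul_le_of_le_one_right (abs_nonneg _) hη1)
      (mul_le_of_le_one_right (abs_nonneg _) hκ1)
  have key : l * t * (ql + (qs - ql) * κ) + (qs - ql) * η * κ * (1 - E) +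
      2 * ((l * t * (ml + (ms - ml) * κ)) ^ 2 / 2 +
        2 * (ms - ml) * η * κ * (ml + (ms - ml) * κ) * (l * t) -
        2 * (ms - ml) * η * κ ^ 2 * (ml + (ms - ml) * κ) * (1 - E) +
        κ ^ 2 * (ms - ml) ^ 2 * η ^ 2 * (1 - E - F)) -
      ((ql * η + qs * κ + 4 * (ms - ml) * η * κ * (ml * η + ms * κ)) * l * t +
        (ml * η + ms * κ) ^ 2 * l ^ 2 * t ^ 2) =
      (qs - ql) * (η * κ * (1 - E))
        + (-(4 * ((ms - ml) * (ml * η + ms * κ)) * (η * κ ^ 2 * (1 - E))))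
        + 2 * (ms - ml) ^ 2 * (κ ^ 2 * η ^ 2 * (1 - E - F)) := by
    rw [hsum]; ring
  rw [key]
  have hηκ : η * κ ≤ 1 := mul_le_one₀ hη1 hκ0 hκ1
  have hE' : 0 ≤ 1 - E := by linarith
  have b1 : |η * κ * (1 - E)| ≤ 1 := by
    rw [abs_of_nonneg (by positivity)]
    exact mul_le_one₀ hηκ hE' (by linarith)
  have b2 : |η * κ ^ 2 * (1 - E)| ≤ 1 := by
    rw [abs_of_nonneg (by positivity)]
    exact mul_le_one₀ (mul_le_one₀ hη1 (by positivity) (pow_le_one₀ hκ0 hκ1)) hE' (by linarith)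
  have b3 : |κ ^ 2 * η ^ 2 * (1 - E - F)| ≤ 2 := by
    rw [abs_mul, abs_of_nonneg (by positivity : 0 ≤ κ ^ 2 * η ^ 2)]
    have h1 : κ ^ 2 * η ^ 2 ≤ 1 :=
      mul_le_one₀ (pow_le_one₀ hκ0 hκ1) (by positivity) (pow_le_one₀ hη0 hη1)
    have h2 : |1 - E - F| ≤ 2 := by rw [abs_le]; constructor <;> linarith
    calc κ ^ 2 * η ^ 2 * |1 - E - F| ≤ 1 * 2 := by gcongr
      _ = 2 := one_mul 2
  refine (abs_add_three _ _ _).trans ?_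
  rw [abs_neg, abs_mul (qs - ql), abs_mul (4 * _), abs_mul 4, abs_mul (ms - ml), abs_mul (2 * _),
    abs_mul 2, abs_pow, abs_two, abs_of_nonneg (by norm_num : (0 : ℝ) ≤ 4)]
  refine add_le_add (add_le_add (mul_le_of_le_one_right (abs_nonneg _) b1) ?_) ?_
  · calc 4 * (|ms - ml| * |ml * η + ms * κ|) * |η * κ ^ 2 * (1 - E)|
        ≤ 4 * (|ms - ml| * (|ml| + |ms|)) * 1 := by gcongr
      _ = _ := by ring
  · calc 2 * |ms - ml| ^ 2 * |κ ^ 2 * η ^ 2 * (1 - E - F)| ≤ 2 * |ms - ml| ^ 2 * 2 := by gcongr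
      _ = _ := by ring

variable {L : Measure ℝ≥0}

/-- The ratios lie in `[0, 1]`, so a polynomial in them is a bounded multiplier. This form covers
every integrand of the expansion. -/
lemma integrable_ratio_mul (hβ : 0 ≤ β) {g : ℝ≥0 → ℝ} (hg : Integrable g L)
    (P : MvPolynomial (Fin 2) ℝ) :
    Integrable (fun l : ℝ≥0 => MvPolynomial.eval ![β / (β + l), (l : ℝ) / (β + l)] P * g l) L := by
  induction P using MvPolynomial.induction_on with
  | C c => simpa using hg.const_mul c
  | add P Q hP hQ => simpa [add_mul] using! hP.add hQ
  | mul_X P i hP =>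
    have h : ∀ l : ℝ≥0, 0 ≤ (![β / (β + l), (l : ℝ) / (β + l)] : Fin 2 → ℝ) i ∧
        (![β / (β + l), (l : ℝ) / (β + l)] : Fin 2 → ℝ) i ≤ 1 := fun l => by
      fin_cases i
      · exact ratio_mem hβ l.2
      · simpa [add_comm] using ratio_mem l.2 hβ
    have := hP.bdd_mul (f := fun l : ℝ≥0 => (![β / (β + l), (l : ℝ) / (β + l)] : Fin 2 → ℝ) i)
      (c := 1) (by
        refine Measurable.aestronglyMeasurable ?_
        fin_cases i
        · simp; fun_prop
        · simp; fun_prop)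
      (Eventually.of_forall fun l => by rw [Real.norm_of_nonneg (h l).1]; exact (h l).2)
    refine this.congr (Eventually.of_forall fun l => ?_)
    simp only [map_mul, MvPolynomial.eval_X]
    ring

end Asymptotics

section Coefficients

variable {β : ℝ} {L : Measure ℝ≥0}

lemma integrable_linearCoeff (hβ : 0 ≤ β) (hL : Integrable (fun l : ℝ≥0 => (l : ℝ)) L)
    (ql qs ml ms : ℝ) : Integrable (fun l : ℝ≥0 => linearCoeff ql qs ml ms β l) L := by
  have := integrable_ratio_mul hβ hL (MvPolynomial.C ql * MvPolynomial.X 0 +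
    MvPolynomial.C qs * MvPolynomial.X 1 +
    MvPolynomial.C (4 * (ms - ml)) * MvPolynomial.X 0 * MvPolynomial.X 1 *
      (MvPolynomial.C ml * MvPolynomial.X 0 + MvPolynomial.C ms * MvPolynomial.X 1))
  refine this.congr (Eventually.of_forall fun l => ?_)
  simp [linearCoeff]

lemma integrable_quadraticCoeff (hβ : 0 ≤ β) (hL : Integrable (fun l : ℝ≥0 => (l : ℝ) ^ 2) L)
    (ml ms : ℝ) : Integrable (fun l : ℝ≥0 => quadraticCoeff ml ms β l) L := by
  have := integrable_ratio_mul hβ hL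
    ((MvPolynomial.C ml * MvPolynomial.X 0 + MvPolynomial.C ms * MvPolynomial.X 1) ^ 2)
  refine this.congr (Eventually.of_forall fun l => ?_)
  simp [quadraticCoeff]

/-- The expansion of the second moment, with the coefficients of `t` and `t ^ 2` collected. -/
lemma expansion_eq (hβ : 0 ≤ β) (hL1 : Integrable (fun l : ℝ≥0 => (l : ℝ)) L)
    (hL2 : Integrable (fun l : ℝ≥0 => (l : ℝ) ^ 2) L) (ql qs ml ms t : ℝ) :
    ql * (∫ l : ℝ≥0, β / (β + l) * l ∂L) + qs * (∫ l : ℝ≥0, (l : ℝ) / (β + l) * l ∂L)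
      + ml ^ 2 * (∫ l : ℝ≥0, (-(4 * β ^ 2 * (l : ℝ) ^ 2 / (β + l) ^ 3)
            + t * (β ^ 2 * (l : ℝ) ^ 2 / (β + l) ^ 2)) ∂L)
      + ml * ms * (∫ l : ℝ≥0, (4 * β * (l : ℝ) ^ 2 * (β - l) / (β + l) ^ 3
            + t * (2 * β * (l : ℝ) ^ 3 / (β + l) ^ 2)) ∂L)
      + ms ^ 2 * (∫ l : ℝ≥0, (4 * β * (l : ℝ) ^ 3 / (β + l) ^ 3
            + t * ((l : ℝ) ^ 4 / (β + l) ^ 2)) ∂L) =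
    ∫ l : ℝ≥0, linearCoeff ql qs ml ms β l ∂L + t * ∫ l : ℝ≥0, quadraticCoeff ml ms β l ∂L := by
  have i1 : Integrable (fun l : ℝ≥0 => β / (β + l) * l) L := by
    simpa using integrable_ratio_mul hβ hL1 (MvPolynomial.X 0)
  have i2 : Integrable (fun l : ℝ≥0 => (l : ℝ) / (β + l) * l) L := by
    simpa using integrable_ratio_mul hβ hL1 (MvPolynomial.X 1)
  -- At `β = l = 0` division by zero gives `0`, in agreement with the convention of the theorem.
  have hc : ∀ l : ℝ≥0, (β = 0 ∧ l = 0) ∨ β + (l : ℝ) ≠ 0 := fun l => by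
    by_cases h : β + (l : ℝ) = 0
    · left
      have := l.2
      exact ⟨by linarith, NNReal.coe_eq_zero.1 (by linarith)⟩
    · exact Or.inr h
  have i3 : Integrable (fun l : ℝ≥0 => -(4 * β ^ 2 * (l : ℝ) ^ 2 / (β + l) ^ 3)
      + t * (β ^ 2 * (l : ℝ) ^ 2 / (β + l) ^ 2)) L := by
    have := (integrable_ratio_mul hβ hL1
        (MvPolynomial.C (-4) * MvPolynomial.X 0 ^ 2 * MvPolynomial.X 1)).add
      (integrable_ratio_mul hβ hL2 (MvPolynomial.C t * MvPolynomial.X 0 ^ 2))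
    refine this.congr (Eventually.of_forall fun l => ?_)
    rcases hc l with ⟨rfl, rfl⟩ | h
    · simp
    · simp; field_simp
  have i4 : Integrable (fun l : ℝ≥0 => 4 * β * (l : ℝ) ^ 2 * (β - l) / (β + l) ^ 3
      + t * (2 * β * (l : ℝ) ^ 3 / (β + l) ^ 2)) L := by
    have := (integrable_ratio_mul hβ hL1
        (MvPolynomial.C 4 * MvPolynomial.X 0 * MvPolynomial.X 1 *
          (MvPolynomial.X 0 - MvPolynomial.X 1))).add
      (integrable_ratio_mul hβ hL2
        (MvPolynomial.C (2 * t) * MvPolynomial.X 0 * MvPolynomial.X 1))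
    refine this.congr (Eventually.of_forall fun l => ?_)
    rcases hc l with ⟨rfl, rfl⟩ | h
    · simp
    · simp; field_simp
  have i5 : Integrable (fun l : ℝ≥0 => 4 * β * (l : ℝ) ^ 3 / (β + l) ^ 3
      + t * ((l : ℝ) ^ 4 / (β + l) ^ 2)) L := by
    have := (integrable_ratio_mul hβ hL1
        (MvPolynomial.C 4 * MvPolynomial.X 0 * MvPolynomial.X 1 ^ 2)).add
      (integrable_ratio_mul hβ hL2 (MvPolynomial.C t * MvPolynomial.X 1 ^ 2))
    refine this.congr (Eventually.of_forall fun l => ?_)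
    rcases hc l with ⟨rfl, rfl⟩ | h
    · simp
    · simp; field_simp
  simp only [← integral_const_mul]
  rw [← integral_add (i1.const_mul ql) (i2.const_mul qs),
    ← integral_add ((i1.const_mul ql).fun_add (i2.const_mul qs)) (i3.const_mul _),
    ← integral_add (((i1.const_mul ql).fun_add (i2.const_mul qs)).fun_add (i3.const_mul _))
      (i4.const_mul _),
    ← integral_add ((((i1.const_mul ql).fun_add (i2.const_mul qs)).fun_add
      (i3.const_mul _)).fun_add (i4.const_mul _)) (i5.const_mul _),
    ← integral_add (integrable_linearCoeff hβ hL1 ql qs ml ms)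
      ((integrable_quadraticCoeff hβ hL2 ml ms).const_mul t)]
  refine integral_congr_ae (Eventually.of_forall fun l => ?_)
  simp only [linearCoeff, quadraticCoeff]
  rcases hc l with ⟨rfl, rfl⟩ | h
  · simp
  · field_simp; ring

variable [IsProbabilityMeasure L]

/-- A bounded perturbation of an integrable linear term, by `abs_moments_sub_le` with both means set
to zero. The next lemma sets the second moments to zero instead. -/
lemma integrable_firstMoment (hβ : 0 ≤ β) (hL : Integrable (fun l : ℝ≥0 => (l : ℝ)) L)
    (ql qs : ℝ) {t : ℝ} (ht : 0 ≤ t) :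
    Integrable (fun l : ℝ≥0 => firstMoment ql (qs - ql) β t l) L := by
  have h1 := (integrable_linearCoeff hβ hL ql qs 0 0).mul_const t
  have h2 : Integrable (fun l : ℝ≥0 => firstMoment ql (qs - ql) β t l -
      linearCoeff ql qs 0 0 β l * t) L := by
    refine Integrable.of_bound (C := |qs - ql|)
      (by unfold firstMoment linearCoeff; exact Measurable.aestronglyMeasurable (by fun_prop))
      (Eventually.of_forall fun l => ?_)
    simpa [secondMoment, quadraticCoeff] using abs_moments_sub_le hβ ql qs 0 0 ht l.2
  simpa using h2.fun_add h1

lemma integrable_secondMoment (hβ : 0 ≤ β) (hL : Integrable (fun l : ℝ≥0 => (l : ℝ)) L)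
    (hL2 : Integrable (fun l : ℝ≥0 => (l : ℝ) ^ 2) L) (ml ms : ℝ) {t : ℝ} (ht : 0 ≤ t) :
    Integrable (fun l : ℝ≥0 => secondMoment ml (ms - ml) β t l) L := by
  have h1 := ((integrable_linearCoeff hβ hL 0 0 ml ms).mul_const t).fun_add
    ((integrable_quadraticCoeff hβ hL2 ml ms).mul_const (t ^ 2))
  have h2 : Integrable (fun l : ℝ≥0 => 2 * secondMoment ml (ms - ml) β t l -
      (linearCoeff 0 0 ml ms β l * t + quadraticCoeff ml ms β l * t ^ 2)) L := by
    refine Integrable.of_bound (C := 4 * |ms - ml| * (|ml| + |ms|) + 4 * |ms - ml| ^ 2)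
      (by unfold secondMoment linearCoeff quadraticCoeff
          exact Measurable.aestronglyMeasurable (by fun_prop))
      (Eventually.of_forall fun l => ?_)
    simpa [firstMoment] using abs_moments_sub_le hβ 0 0 ml ms ht l.2
  simpa using (h2.fun_add h1).div_const 2

end Coefficients

/-! ### Passage to the limit and the case of one type of claims -/

/-- The second moment of the aggregate claim is a quadratic polynomial in `t`, up to a bounded
remainder. -/
theorem abs_integral_aggregateClaim_sq_sub_le {Ω : Type*} [MeasurableSpace Ω] {μ : Measure Ω}
    [IsProbabilityMeasure μ] {L : Measure ℝ≥0} [IsProbabilityMeasure L]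
    (hL : MemLp (fun l : ℝ≥0 => (l : ℝ)) 2 L)
    {Hl Hs : Measure ℝ} [IsProbabilityMeasure Hl] [IsProbabilityMeasure Hs]
    (hHl : MemLp (fun y : ℝ => y) 2 Hl) (hHs : MemLp (fun y : ℝ => y) 2 Hs)
    {β : ℝ} (hβ : 0 ≤ β) {N : ℝ≥0 → Ω → ℕ} (hN : IsMixedPoissonProcess N L μ)
    {X : ℕ → Ω → ℝ} (hX : IsClaimSizes X N β Hl Hs μ) :
    ∃ C : ℝ, ∀ t : ℝ≥0, 0 < t → |(∫ ω, aggregateClaim X N t ω ^ 2 ∂μ) -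
      ((∫ l : ℝ≥0, linearCoeff (∫ y, y ^ 2 ∂Hl) (∫ y, y ^ 2 ∂Hs) (∫ y, y ∂Hl) (∫ y, y ∂Hs)
          β l ∂L) * t +
        (∫ l : ℝ≥0, quadraticCoeff (∫ y, y ∂Hl) (∫ y, y ∂Hs) β l ∂L) * (t : ℝ) ^ 2)| ≤ C := by
  set ql := ∫ y, y ^ 2 ∂Hl
  set qs := ∫ y, y ^ 2 ∂Hs
  set ml := ∫ y, y ∂Hl
  set ms := ∫ y, y ∂Hs
  refine ⟨|qs - ql| + 4 * |ms - ml| * (|ml| + |ms|) + 4 * |ms - ml| ^ 2, fun t ht => ?_⟩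
  have hL1 : Integrable (fun l : ℝ≥0 => (l : ℝ)) L := hL.integrable (by norm_num)
  rw [(hX.aggregateClaim_sq hN.toIsClaimCountingProcess hβ hHl hHs (hN.memLp_two hL t)).2,
    (hN.integral_sum_claimWeight hL _ _ hβ ht).1, (hN.integral_sum_claimWeight hL _ _ hβ ht).2]
  have i1 := integrable_firstMoment hβ hL1 ql qs t.2
  have i2 := (integrable_secondMoment hβ hL1 hL.integrable_sq ml ms t.2).const_mul 2
  have i3 := (integrable_linearCoeff hβ hL1 ql qs ml ms).mul_const t
  have i4 := (integrable_quadraticCoeff hβ hL.integrable_sq ml ms).mul_const ((t : ℝ) ^ 2)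
  rw [← integral_const_mul, ← integral_mul_const, ← integral_mul_const]
  have e := (integral_sub (i1.fun_add i2) (i3.fun_add i4)).symm
  rw [integral_add i1 i2, integral_add i3 i4] at e
  refine (congrArg abs e).trans_le ?_
  have := norm_integral_le_of_norm_le_const (μ := L) (f := fun l : ℝ≥0 =>
    firstMoment ql (qs - ql) β t l + 2 * secondMoment ml (ms - ml) β t l
      - (linearCoeff ql qs ml ms β l * t + quadraticCoeff ml ms β l * (t : ℝ) ^ 2))
    (Eventually.of_forall fun l : ℝ≥0 =>
    abs_moments_sub_le hβ ql qs ml ms t.2 l.2)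
  simpa using! this

lemma tendsto_coe_div_nnreal (c : ℝ) : Tendsto (fun t : ℝ≥0 => c / (t : ℝ)) atTop (𝓝 0) :=
  (tendsto_const_nhds (x := c)).div_atTop (NNReal.tendsto_coe_atTop.2 tendsto_id)

lemma tendsto_div_sub_of_abs_sub_le {f : ℝ≥0 → ℝ} {A B C : ℝ}
    (h : ∀ t : ℝ≥0, 0 < t → |f t - (A * t + B * (t : ℝ) ^ 2)| ≤ C) :
    Tendsto (fun t : ℝ≥0 => f t / (t : ℝ) - (A + t * B)) atTop (𝓝 0) := by
  refine squeeze_zero_norm' ?_ (tendsto_coe_div_nnreal C)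
  filter_upwards [eventually_gt_atTop 0] with t ht
  have ht' : (0 : ℝ) < t := by exact_mod_cast ht
  have e : f t / (t : ℝ) - (A + t * B) = (f t - (A * t + B * (t : ℝ) ^ 2)) / t := by
    field_simp
  rw [e, norm_div, Real.norm_of_nonneg ht'.le]
  gcongr
  exact h t ht

lemma tendsto_div_sq_of_tendsto_div_sub {f : ℝ≥0 → ℝ} {A B : ℝ}
    (h : Tendsto (fun t : ℝ≥0 => f t / (t : ℝ) - (A + t * B)) atTop (𝓝 0)) :
    Tendsto (fun t : ℝ≥0 => f t / (t : ℝ) ^ 2) atTop (𝓝 B) := by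
  have := ((h.mul (tendsto_coe_div_nnreal 1)).add (tendsto_coe_div_nnreal A)).add_const B
  simp only [mul_zero, zero_add] at this
  refine this.congr' ?_
  filter_upwards [eventually_gt_atTop 0] with t ht
  have ht' : (t : ℝ) ≠ 0 := by exact_mod_cast ht.ne'
  field_simp
  ring

theorem mainTheorem7 {Ω : Type*} [MeasurableSpace Ω] (μ : Measure Ω) [IsProbabilityMeasure μ]
    (L : Measure ℝ≥0) [IsProbabilityMeasure L] (hL : MemLp (fun l : ℝ≥0 => (l : ℝ)) 2 L)
    (Hl Hs : Measure ℝ) [IsProbabilityMeasure Hl] [IsProbabilityMeasure Hs]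
    (hHl : MemLp (fun y : ℝ => y) 2 Hl) (hHs : MemLp (fun y : ℝ => y) 2 Hs)
    (β : ℝ) (hβ : 0 ≤ β)
    (N : ℝ≥0 → Ω → ℕ) (hN : IsMixedPoissonProcess N L μ)
    (X : ℕ → Ω → ℝ) (hX : IsClaimSizes X N β Hl Hs μ) :
    -- `S t` has a finite second moment
    (∀ t : ℝ≥0, MemLp (aggregateClaim X N t) 2 μ) ∧
    -- the expansion of `E[S²(t)] / t` up to `o(1)`
    Tendsto (fun t : ℝ≥0 => (∫ ω, aggregateClaim X N t ω ^ 2 ∂μ) / (t : ℝ) -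
      ((∫ y, y ^ 2 ∂Hl) * (∫ l : ℝ≥0, β / (β + l) * l ∂L)
        + (∫ y, y ^ 2 ∂Hs) * (∫ l : ℝ≥0, (l : ℝ) / (β + l) * l ∂L)
        + (∫ y, y ∂Hl) ^ 2 * (∫ l : ℝ≥0, (-(4 * β ^ 2 * (l : ℝ) ^ 2 / (β + l) ^ 3)
            + (t : ℝ) * (β ^ 2 * (l : ℝ) ^ 2 / (β + l) ^ 2)) ∂L)
        + (∫ y, y ∂Hl) * (∫ y, y ∂Hs) *
            (∫ l : ℝ≥0, (4 * β * (l : ℝ) ^ 2 * (β - l) / (β + l) ^ 3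
              + (t : ℝ) * (2 * β * (l : ℝ) ^ 3 / (β + l) ^ 2)) ∂L)
        + (∫ y, y ∂Hs) ^ 2 * (∫ l : ℝ≥0, (4 * β * (l : ℝ) ^ 3 / (β + l) ^ 3
            + (t : ℝ) * ((l : ℝ) ^ 4 / (β + l) ^ 2)) ∂L)))
      atTop (𝓝 0) ∧
    -- the limit of `E[S²(t)] / t²`
    Tendsto (fun t : ℝ≥0 => (∫ ω, aggregateClaim X N t ω ^ 2 ∂μ) / (t : ℝ) ^ 2) atTop
      (𝓝 (∫ l : ℝ≥0, ((∫ y, y ∂Hl) * (β / (β + l)) + (∫ y, y ∂Hs) * ((l : ℝ) / (β + l))) ^ 2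
        * (l : ℝ) ^ 2 ∂L)) ∧
    -- one type of claims, `Y` having the law `Hl = Hs`
    (Hl = Hs →
      Tendsto (fun t : ℝ≥0 => (∫ ω, aggregateClaim X N t ω ^ 2 ∂μ) / (t : ℝ) ^ 2) atTop
        (𝓝 ((∫ y, y ∂Hl) ^ 2 * ∫ l : ℝ≥0, (l : ℝ) ^ 2 ∂L)) ∧
      Tendsto (fun t : ℝ≥0 => Var[aggregateClaim X N t; μ] / (t : ℝ) ^ 2) atTop
        (𝓝 ((∫ y, y ∂Hl) ^ 2 * Var[fun l : ℝ≥0 => (l : ℝ); L])) ∧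
      (Var[fun l : ℝ≥0 => (l : ℝ); L] = 0 →
        Tendsto (fun t : ℝ≥0 => Var[aggregateClaim X N t; μ] / (t : ℝ)) atTop
          (𝓝 ((∫ y, y ^ 2 ∂Hl) * ∫ l : ℝ≥0, (l : ℝ) ∂L)))) := by
  have hL1 : Integrable (fun l : ℝ≥0 => (l : ℝ)) L := hL.integrable (by norm_num)
  have hN' := hN.toIsClaimCountingProcess
  have hmem := fun t => (hX.aggregateClaim_sq hN' hβ hHl hHs (hN.memLp_two hL t)).1
  obtain ⟨C, hC⟩ := abs_integral_aggregateClaim_sq_sub_le hL hHl hHs hβ hN hX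
  have lim1 := tendsto_div_sub_of_abs_sub_le hC
  have lim2 := tendsto_div_sq_of_tendsto_div_sub lim1
  refine ⟨hmem, ?_, lim2, ?_⟩
  · refine lim1.congr fun t => ?_
    rw [expansion_eq hβ hL1 hL.integrable_sq]
  rintro rfl
  have hratio : ∀ l : ℝ≥0, (β / (β + l) + (l : ℝ) / (β + l)) * l = l := fun l => by
    rcases eq_or_ne (β + (l : ℝ)) 0 with h | h
    · have : (l : ℝ) = 0 := by linarith [l.2]
      simp [this]
    · rw [← add_div, div_self h, one_mul]
  have hlin : ∫ l : ℝ≥0, linearCoeff (∫ y, y ^ 2 ∂Hl) (∫ y, y ^ 2 ∂Hl) (∫ y, y ∂Hl) (∫ y, y ∂Hl)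
      β l ∂L = (∫ y, y ^ 2 ∂Hl) * ∫ l : ℝ≥0, (l : ℝ) ∂L := by
    rw [← integral_const_mul]
    refine integral_congr_ae (Eventually.of_forall fun l => ?_)
    simp only [linearCoeff]
    linear_combination (∫ y, y ^ 2 ∂Hl) * hratio l
  have hquad : ∫ l : ℝ≥0, quadraticCoeff (∫ y, y ∂Hl) (∫ y, y ∂Hl) β l ∂L =
      (∫ y, y ∂Hl) ^ 2 * ∫ l : ℝ≥0, (l : ℝ) ^ 2 ∂L := by
    rw [← integral_const_mul]
    refine integral_congr_ae (Eventually.of_forall fun l => ?_)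
    simp only [quadraticCoeff]
    rw [← mul_add, mul_pow, mul_assoc, ← mul_pow, hratio]
  rw [hlin, hquad] at lim1
  rw [hquad] at lim2
  -- With one type of claims the coefficient of `exp (-β V)` is zero, so the first moment is linear
  -- in `t` without remainder.
  have hmean : ∀ t : ℝ≥0, 0 < t → ∫ ω, aggregateClaim X N t ω ∂μ =
      (∫ y, y ∂Hl) * (∫ l : ℝ≥0, (l : ℝ) ∂L) * t := fun t ht => by
    rw [hX.integral_aggregateClaim hN' hβ (hHl.integrable (by norm_num))
      (hHl.integrable (by norm_num)) ((hN.memLp_two hL t).integrable (by norm_num))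
      ((hmem t).integrable (by norm_num)), (hN.integral_sum_claimWeight hL _ _ hβ ht).1,
      ← integral_const_mul, ← integral_mul_const]
    refine integral_congr_ae (Eventually.of_forall fun l => ?_)
    simp only [firstMoment]
    ring
  have hvar : ∀ t : ℝ≥0, 0 < t → Var[aggregateClaim X N t; μ] =
      (∫ ω, aggregateClaim X N t ω ^ 2 ∂μ) -
        ((∫ y, y ∂Hl) * (∫ l : ℝ≥0, (l : ℝ) ∂L) * t) ^ 2 := fun t ht => by
    rw [variance_eq_sub (hmem t), hmean t ht]
    rfl
  have hvarL : Var[fun l : ℝ≥0 => (l : ℝ); L] =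
      (∫ l : ℝ≥0, (l : ℝ) ^ 2 ∂L) - (∫ l : ℝ≥0, (l : ℝ) ∂L) ^ 2 := by
    rw [variance_eq_sub hL]
    rfl
  refine ⟨lim2, ?_, fun h0 => ?_⟩
  · rw [hvarL, mul_sub, ← mul_pow]
    refine (lim2.sub_const _).congr' ?_
    filter_upwards [eventually_gt_atTop 0] with t ht
    have ht' : (t : ℝ) ≠ 0 := by exact_mod_cast ht.ne'
    rw [hvar t ht]
    field_simp
  · rw [hvarL, sub_eq_zero] at h0
    -- Since `E[Λ²] = (E[Λ])²`, the term of order `t` in `E[S²(t)] / t` is exactly the squared mean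
    -- divided by `t`.
    rw [h0] at lim1
    have := lim1.add_const ((∫ y, y ^ 2 ∂Hl) * ∫ l : ℝ≥0, (l : ℝ) ∂L)
    rw [zero_add] at this
    refine this.congr' ?_
    filter_upwards [eventually_gt_atTop 0] with t ht
    have ht' : (t : ℝ) ≠ 0 := by exact_mod_cast ht.ne'
    rw [hvar t ht]
    field_simp
    ring
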